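/- **The problem.** An instance of the Map-Shuffle-Reduce problem consists of a finite set $\mathcal J$ of jobs and two disjoint non-empty finite sets $\mathcal P_{\mathcal M}$, $\mathcal P_{\mathcal R}$ of unrelated (Map, resp. Reduce) processors. Job $j$ has a weight $w_j>0$, at least one Map task and at least one Reduce task. Map task $k$ of job $j$ needs time $p_{i,k,j}\ge 0$ on processor $i\in\mathcal P_{\mathcal M}$, Reduce task $r$ of job $j$ needs time $p_{i,r,j}\ge 0$ on $i\in\mathcal P_{\mathcal R}$, and for each pair of a Reduce task $r$ and a Map task $k$ of job $j$ there is a Shuffle task with transfer time $t_{r,k,j}\ge 0$. A feasible schedule executes all tasks non-preemptively from time $0$ on, Map tasks on processors of $\mathcal P_{\mathcal M}$, Reduce tasks on processors of $\mathcal P_{\mathcal R}$, and each Shuffle task on the same processor as its Reduce task; tasks on the same processor do not overlap; a Shuffle task starts no earlier than the completion of its Map task; a Reduce task starts no earlier than the completion of all its Shuffle tasks. The completion time $C_j$ of job $j$ is the largest completion time of its Reduce tasks, and the cost of a schedule is $\sum_j w_jC_j$. Time is measured in a unit in which every nonzero processing or transfer time is at least $1$ (for example, all times are non-negative integers). **TaskScheduling.**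 Let $b$ be a set of tasks of the jobs, with processors $\mathcal P_b$ and processing times $p_{i,k,j}$; put $\delta=1/2$, $a=3/2$. A task with processing time $0$ on some processor is executed first, on such a processor. For the set $b$ of the other tasks, let $t_{\max}=\sum_{(k,j)\in b}\max_i p_{i,k,j}$, let $L\ge 1$ be the smallest integer with $(1+\delta)^{L-1}\ge t_{\max}$, and take an optimal solution of the linear program: minimize $\sum_j w_jC_{D_j}$ over variables $y_{i,k,j,\ell}\ge 0$ ($1\le \ell\le L$), $C_{k,j}$, $C_{D_j}\ge 0$ subject to $\sum_{i,\ell}y_{i,k,j,\ell}\ge 1$; $C_{D_j}\ge C_{k,j}$; $\sum_{i,\ell}(1+\delta)^{\ell-1}y_{i,k,j,\ell}\le C_{k,j}$; $\sum_{(k,j)\in b}p_{i,k,j}\sum_{t\le\ell}y_{i,k,j,t}\le(1+\delta)^\ell$ for all $i,\ell$; and $y_{i,k,j,\ell}=0$ whenever $p_{i,k,j}>(1+\delta)^\ell$. Put each task into a class $S(\ell)$, $1\le\ell\le L$, with $(1+\delta)^{\ell-1}\le aC_{k,j}\le(1+\delta)^\ell$. For each $\ell$, assign the tasks of $S(\ell)$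 to processors by the Shmoys–Tardos rounding of $y^*_{i,k,j}=\frac a{a-1}\sum_{t\le\ell}y_{i,k,j,t}$: for each processor $i$, place the tasks of $S(\ell)$ in order of non-increasing $p_{i,k,j}$ consecutively on a line, each with length $y^*_{i,k,j}$, cut the line into slots of length $1$, choose a matching that matches every task of $S(\ell)$ to a slot (of some processor) that it meets in positive length, no two tasks to the same slot, and assign each task to the processor of its slot. Finally, every processor executes its tasks without idle time, in increasing order of the classes and in any order within a class. **MRS.** Given Map and Reduce tasks, run TaskScheduling on the Map tasks and on the Reduce tasks separately. The width $\omega_j$ of job $j$ is the larger of the completion time of its last Map task in the first schedule and of its last Reduce task in the second one. Keep the processors of all tasks. Whenever a Map processor becomes available, it executes, among its unscheduled Map tasks, one of smallest $\omega_j$; whenever a Reduce processor is available at time $t$, it executes, among its unscheduled Reduce tasks with $\omega_j\le t$, one of smallest $\omega_j$, and if there is none it waits until there is one. For the Map-Shuffle-Reduce problem, run MRS on the modified instance without Shuffle tasks in which the time of Reduce task $r$ of job $j$ on $i\in\mathcal P_{\mathcal R}$ is $p'_{i,r,j}=p_{i,r,j}+\sum_k t_{r,k,j}$; within the time reserved for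 it, execute first its Shuffle tasks, consecutively and in any order, and then the Reduce task itself. **Theorem 3.** MRS is a 54-approximation for the Map-Shuffle-Reduce problem: on every instance MRS can be carried out (all optimal solutions, classes and matchings that it needs exist), and, whichever choices it makes, the schedule it computes is feasible and its total weighted completion time is at most $54$ times that of every feasible schedule. -/

import Mathlib

namespace MapReduce

/-! ## The Map-Shuffle-Reduce problem -/

/-- An instance of the Map-Reduce problem.  Each job `j` has a positive weight, at least one Map
task and at least one Reduce task; the processors are unrelated.  The Map processors `PM` and the
Reduce processors `PR` are different types, so the two sets of processors are disjoint. -/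
structure MRInstance (J PM PR : Type*) where
  w : J → ℝ
  numMap : J → ℕ
  numReduce : J → ℕ
  pMap : PM → (j : J) → Fin (numMap j) → ℝ
  pReduce : PR → (j : J) → Fin (numReduce j) → ℝ
  w_pos : ∀ j, 0 < w j
  numMap_pos : ∀ j, 0 < numMap j
  numReduce_pos : ∀ j, 0 < numReduce j
  pMap_nonneg : ∀ i j k, 0 ≤ pMap i j k
  pReduce_nonneg : ∀ i j r, 0 ≤ pReduce i j r

/-- An instance of the Map-Shuffle-Reduce problem: for every pair of a Reduce task `r` and a Map
task `k` of the same job `j` there is one Shuffle task, with transfer time `transfer j r k`. -/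
structure MSRInstance (J PM PR : Type*) extends MRInstance J PM PR where
  transfer : (j : J) → Fin (numReduce j) → Fin (numMap j) → ℝ
  transfer_nonneg : ∀ j r k, 0 ≤ transfer j r k

/-- The Map tasks. -/
abbrev MRInstance.MapTask {J PM PR : Type*} (I : MRInstance J PM PR) : Type _ :=
  (j : J) × Fin (I.numMap j)

/-- The Reduce tasks. -/
abbrev MRInstance.ReduceTask {J PM PR : Type*} (I : MRInstance J PM PR) : Type _ :=
  (j : J) × Fin (I.numReduce j)

/-- The Shuffle tasks: `⟨j, (r, k)⟩` belongs to the Reduce task `r` and the Map task `k`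
of the job `j`. -/
abbrev MSRInstance.ShuffleTask {J PM PR : Type*} (I : MSRInstance J PM PR) : Type _ :=
  (j : J) × (Fin (I.numReduce j) × Fin (I.numMap j))

/-- A (non-preemptive) schedule of the Map and Reduce tasks: a processor and a start time
for every task. -/
structure MRSchedule {J PM PR : Type*} (I : MRInstance J PM PR) where
  mapProc : I.MapTask → PM
  mapStart : I.MapTask → ℝ
  reduceProc : I.ReduceTask → PR
  reduceStart : I.ReduceTask → ℝ

/-- A (non-preemptive) schedule for the Map-Shuffle-Reduce problem.  A Shuffle task has no
processor of its own: it runs on the processor of its Reduce task. -/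
structure MSRSchedule {J PM PR : Type*} (I : MSRInstance J PM PR) extends
    MRSchedule I.toMRInstance where
  shuffleStart : I.ShuffleTask → ℝ

/-- Any two tasks on the same processor are executed one after the other. -/
def NonOverlapping {T P : Type*} (proc : T → P) (start finish : T → ℝ) : Prop :=
  ∀ a b, a ≠ b → proc a = proc b → finish a ≤ start b ∨ finish b ≤ start a

namespace MSRSchedule

variable {J PM PR : Type*} {I : MSRInstance J PM PR}

/-- Completion time of a Map task. -/
def mapFinish (σ : MSRSchedule I) (k : I.MapTask) : ℝ :=
  σ.mapStart k + I.pMap (σ.mapProc k) k.1 k.2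

/-- Completion time of a Reduce task. -/
def reduceFinish (σ : MSRSchedule I) (r : I.ReduceTask) : ℝ :=
  σ.reduceStart r + I.pReduce (σ.reduceProc r) r.1 r.2

/-- Completion time of a Shuffle task. -/
def shuffleFinish (σ : MSRSchedule I) (h : I.ShuffleTask) : ℝ :=
  σ.shuffleStart h + I.transfer h.1 h.2.1 h.2.2

/-- Feasibility of a schedule: nothing starts before time zero; tasks on the same processor do not
overlap, where the Reduce processors execute the Reduce tasks and their Shuffle tasks; a Shuffle
task starts after the completion of its Map task, and a Reduce task starts after the completion of
all its Shuffle tasks (hence after the completion of all Map tasks of its job). -/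
structure Feasible (σ : MSRSchedule I) : Prop where
  mapStart_nonneg : ∀ k, 0 ≤ σ.mapStart k
  shuffleStart_nonneg : ∀ h, 0 ≤ σ.shuffleStart h
  reduceStart_nonneg : ∀ r, 0 ≤ σ.reduceStart r
  map_nonOverlapping : NonOverlapping σ.mapProc σ.mapStart σ.mapFinish
  reduce_nonOverlapping :
    NonOverlapping (T := I.ReduceTask ⊕ I.ShuffleTask)
      (Sum.elim σ.reduceProc (fun h => σ.reduceProc ⟨h.1, h.2.1⟩))
      (Sum.elim σ.reduceStart σ.shuffleStart)
      (Sum.elim σ.reduceFinish σ.shuffleFinish)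
  map_before_shuffle : ∀ j r k, σ.mapFinish ⟨j, k⟩ ≤ σ.shuffleStart ⟨j, (r, k)⟩
  shuffle_before_reduce : ∀ j r k, σ.shuffleFinish ⟨j, (r, k)⟩ ≤ σ.reduceStart ⟨j, r⟩

/-- Completion time of a job: the largest completion time of its Reduce tasks. -/
noncomputable def jobFinish (σ : MSRSchedule I) (j : J) : ℝ :=
  Finset.univ.sup' ⟨⟨0, I.numReduce_pos j⟩, Finset.mem_univ _⟩
    (fun r : Fin (I.numReduce j) => σ.reduceFinish ⟨j, r⟩)

/-- Total weighted completion time. -/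
noncomputable def cost [Fintype J] (σ : MSRSchedule I) : ℝ :=
  ∑ j, I.w j * σ.jobFinish j

end MSRSchedule

/-! ## TaskScheduling: one stage on unrelated processors -/

/-- The parameter `δ` of the geometric time intervals. -/
noncomputable def delta : ℝ := 1 / 2

/-- The parameter `a` of the rounding. -/
noncomputable def alpha : ℝ := 3 / 2

/-- The tasks of one stage (Map tasks, or Reduce tasks), with the processors of this stage. -/
structure Stage (J T P : Type*) where
  w : J → ℝ
  job : T → J
  p : P → T → ℝ

namespace Stage

variable {J T P : Type*}

open Classical in
/-- The tasks that enter the linear program: those with a positive processing time on every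
processor.  The remaining tasks are executed in no time on some processor. -/
noncomputable def active [Fintype T] (S : Stage J T P) : Finset T :=
  Finset.univ.filter (fun k => ∀ i, 0 < S.p i k)

/-- The time horizon: the sum of the largest processing times. -/
noncomputable def tMax [Fintype T] [Fintype P] [Nonempty P] (S : Stage J T P) : ℝ :=
  ∑ k ∈ S.active, Finset.univ.sup' Finset.univ_nonempty (fun i => S.p i k)

/-- The number of intervals: the smallest `L ≥ 1` with `(1 + δ) ^ (L - 1) ≥ t_max`, where time
is measured in the unit `u`. -/
noncomputable def numIntervals [Fintype T] [Fintype P] [Nonempty P] (S : Stage J T P) (u : ℝ) : ℕ :=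
  sInf {L : ℕ | 1 ≤ L ∧ S.tMax ≤ u * (1 + delta) ^ (L - 1)}

/-- The constraints of the interval-indexed linear program.  The variable `y i k l` says to which
extent the task `k` completes on the processor `i` in the interval
`(u (1 + δ) ^ (l - 1), u (1 + δ) ^ l]`, `C k` stands for the completion time of the task `k`,
and `D j` for the completion time of the dummy task of the job `j`. -/
structure LPFeasible [Fintype T] [Fintype P] [Nonempty P] (S : Stage J T P) (u : ℝ)
    (y : P → T → ℕ → ℝ) (C : T → ℝ) (D : J → ℝ) : Prop where
  cover : ∀ k ∈ S.active, 1 ≤ ∑ i, ∑ l ∈ Finset.Icc 1 (S.numIntervals u), y i k l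
  dummy : ∀ k ∈ S.active, C k ≤ D (S.job k)
  dummy_nonneg : ∀ j, 0 ≤ D j
  lower : ∀ k ∈ S.active,
    ∑ i, ∑ l ∈ Finset.Icc 1 (S.numIntervals u), u * (1 + delta) ^ (l - 1) * y i k l ≤ C k
  load : ∀ i, ∀ l ∈ Finset.Icc 1 (S.numIntervals u),
    ∑ k ∈ S.active, S.p i k * ∑ t ∈ Finset.Icc 1 l, y i k t ≤ u * (1 + delta) ^ l
  too_long : ∀ i, ∀ k ∈ S.active, ∀ l ∈ Finset.Icc 1 (S.numIntervals u),
    u * (1 + delta) ^ l < S.p i k → y i k l = 0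
  nonneg : ∀ i, ∀ k ∈ S.active, ∀ l ∈ Finset.Icc 1 (S.numIntervals u), 0 ≤ y i k l

/-- Optimal solutions of the linear program: minimize `∑ j, w j * D j`. -/
def LPOptimal [Fintype J] [Fintype T] [Fintype P] [Nonempty P] (S : Stage J T P) (u : ℝ)
    (y : P → T → ℕ → ℝ) (C : T → ℝ) (D : J → ℝ) : Prop :=
  S.LPFeasible u y C D ∧
    ∀ y' C' D', S.LPFeasible u y' C' D' → ∑ j, S.w j * D j ≤ ∑ j, S.w j * D' j

/-- The truncated and rescaled fractional assignment: a task `k` of the class `cls k` is assigned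
to the processor `i` to the extent `a / (a - 1) * ∑ t ≤ cls k, y i k t`. -/
noncomputable def yStar (y : P → T → ℕ → ℝ) (cls : T → ℕ) (i : P) (k : T) : ℝ :=
  alpha / (alpha - 1) * ∑ t ∈ Finset.Icc 1 (cls k), y i k t

open Classical in
/-- The fractional amount on the processor `i` of the tasks that belong to the class of `k` and
precede `k` in the order `ord i`. -/
noncomputable def amountBefore [Fintype T] (S : Stage J T P) (y : P → T → ℕ → ℝ) (cls : T → ℕ)
    (ord : P → T → ℕ) (i : P) (k : T) : ℝ :=
  ∑ k' ∈ S.active.filter (fun k' => cls k' = cls k ∧ ord i k' < ord i k), yStar y cls i k'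

/-- A run of TaskScheduling, with time measured in the unit `u`; all choices that the algorithm
leaves open (the optimal solution, ties, matchings, orders) are recorded in it.

1. Take an optimal solution `(y, C, D)` of the linear program.
2. Put every task `k` into a class `l` with `(1 + δ) ^ (l - 1) ≤ a C k ≤ (1 + δ) ^ l`.
3. Round every class separately, by the rounding of Shmoys and Tardos: on each processor `i` line
   up the tasks of the class in order of non-increasing processing times, the task `k` occupying
   an interval of length `yStar i k`; cut this line into slots `[s, s + 1)` of unit length; match
   each task to a slot of some processor that its interval meets in positive length, different
   tasks of the class to different slots; execute the task on the processor of its slot.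
4. Each processor executes its tasks class by class, in increasing order of the classes, in any
   order within a class, and without idle time.

Tasks that need no time on some processor do not enter the linear program: they are put first
(class `0`), on such a processor. -/
structure TaskSchedulingRun [Fintype J] [Fintype T] [Fintype P] [Nonempty P]
    (S : Stage J T P) (u : ℝ) where
  y : P → T → ℕ → ℝ
  C : T → ℝ
  D : J → ℝ
  optimal : S.LPOptimal u y C D
  cls : T → ℕ
  cls_inactive : ∀ k, k ∉ S.active → cls k = 0
  cls_mem : ∀ k ∈ S.active, cls k ∈ Finset.Icc 1 (S.numIntervals u)
  cls_lower : ∀ k ∈ S.active, u * (1 + delta) ^ (cls k - 1) ≤ alpha * C k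
  cls_upper : ∀ k ∈ S.active, alpha * C k ≤ u * (1 + delta) ^ cls k
  ord : P → T → ℕ
  ord_injective : ∀ i, Function.Injective (ord i)
  ord_sorted : ∀ i k k', ord i k < ord i k' → S.p i k' ≤ S.p i k
  proc : T → P
  slot : T → ℕ
  proc_inactive : ∀ k, k ∉ S.active → S.p (proc k) k = 0
  yStar_pos : ∀ k ∈ S.active, 0 < yStar y cls (proc k) k
  slot_upper : ∀ k ∈ S.active, S.amountBefore y cls ord (proc k) k < (slot k : ℝ) + 1
  slot_lower : ∀ k ∈ S.active,
    (slot k : ℝ) < S.amountBefore y cls ord (proc k) k + yStar y cls (proc k) k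
  slot_matching : ∀ k ∈ S.active, ∀ k' ∈ S.active,
    cls k = cls k' → proc k = proc k' → slot k = slot k' → k = k'
  rank : T → ℕ
  rank_injective : Function.Injective rank
  rank_sorted : ∀ k k', cls k < cls k' → rank k < rank k'

open Classical in
/-- The completion time of a task in the schedule of one stage that TaskScheduling computes. -/
noncomputable def TaskSchedulingRun.finish [Fintype J] [Fintype T] [Fintype P] [Nonempty P]
    {S : Stage J T P} {u : ℝ} (run : S.TaskSchedulingRun u) (k : T) : ℝ :=
  ∑ k' ∈ Finset.univ.filter (fun k' => run.proc k' = run.proc k ∧ run.rank k' ≤ run.rank k),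
    S.p (run.proc k) k'

end Stage

/-! ## MRS: merging the schedules of the two stages -/

/-- The dispatching rule of one processor.  `Dispatch p r ω start t R` says that a processor that
becomes available at time `t`, with the tasks in `R` not yet scheduled, gives them the start times
`start` as follows: among the tasks of `R` that are released (`r k ≤ t`), it executes one with
the smallest `ω`, and becomes available again at its completion; if no task of `R` is released,
it waits for the next release. -/
inductive Dispatch {T : Type*} (p r ω start : T → ℝ) : ℝ → Set T → Prop
  | done (t : ℝ) : Dispatch p r ω start t ∅
  | run (t : ℝ) (R : Set T) (k : T) (mem : k ∈ R) (released : r k ≤ t)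
      (smallest : ∀ k' ∈ R, r k' ≤ t → ω k ≤ ω k') (starts : start k = t)
      (rest : Dispatch p r ω start (t + p k) (R \ {k})) : Dispatch p r ω start t R
  | wait (t t' : ℝ) (R : Set T) (later : t < t') (next : IsLeast (r '' R) t')
      (rest : Dispatch p r ω start t' R) : Dispatch p r ω start t R

namespace MRInstance

variable {J PM PR : Type*}

/-- The Map stage of an instance. -/
def mapStage (I : MRInstance J PM PR) : Stage J I.MapTask PM where
  w := I.w
  job := fun k => k.1
  p := fun i k => I.pMap i k.1 k.2

/-- The Reduce stage of an instance. -/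
def reduceStage (I : MRInstance J PM PR) : Stage J I.ReduceTask PR where
  w := I.w
  job := fun r => r.1
  p := fun i r => I.pReduce i r.1 r.2

/-- The width of a job: the time at which both its Map tasks and its Reduce tasks are completed
in the two separate schedules with the given completion times. -/
noncomputable def width (I : MRInstance J PM PR) (fM : I.MapTask → ℝ) (fR : I.ReduceTask → ℝ)
    (j : J) : ℝ :=
  max
    (Finset.univ.sup' ⟨⟨0, I.numMap_pos j⟩, Finset.mem_univ _⟩
      (fun k : Fin (I.numMap j) => fM ⟨j, k⟩))
    (Finset.univ.sup' ⟨⟨0, I.numReduce_pos j⟩, Finset.mem_univ _⟩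
      (fun r : Fin (I.numReduce j) => fR ⟨j, r⟩))

variable [Fintype J] [Fintype PM] [Fintype PR] [Nonempty PM] [Nonempty PR]

/-- A run of MRS on a Map-Reduce instance: run TaskScheduling on the Map tasks and on the Reduce
tasks, keep the processors of the tasks, and let every Map processor execute its tasks in order of
non-decreasing width, and every Reduce processor those of its tasks that are released, in order of
non-decreasing width, where a Reduce task is released at the time equal to its width. -/
structure MRSRun (I : MRInstance J PM PR) (u : ℝ) where
  mapRun : I.mapStage.TaskSchedulingRun u
  reduceRun : I.reduceStage.TaskSchedulingRun u
  mapStart : I.MapTask → ℝ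
  reduceStart : I.ReduceTask → ℝ
  map_dispatch : ∀ i : PM,
    Dispatch (fun k => I.mapStage.p i k) (fun _ => 0)
      (fun k => I.width mapRun.finish reduceRun.finish k.1) mapStart 0 {k | mapRun.proc k = i}
  reduce_dispatch : ∀ i : PR,
    Dispatch (fun r => I.reduceStage.p i r)
      (fun r => I.width mapRun.finish reduceRun.finish r.1)
      (fun r => I.width mapRun.finish reduceRun.finish r.1) reduceStart 0
      {r | reduceRun.proc r = i}

/-- The schedule computed by MRS. -/
def MRSRun.schedule {I : MRInstance J PM PR} {u : ℝ} (run : I.MRSRun u) : MRSchedule I where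
  mapProc := run.mapRun.proc
  mapStart := run.mapStart
  reduceProc := run.reduceRun.proc
  reduceStart := run.reduceStart

end MRInstance

/-! ## MRS for the Map-Shuffle-Reduce problem -/

namespace MSRInstance

variable {J PM PR : Type*}

/-- `u` is a unit of time for the instance: no nonzero processing or transfer time is shorter
(for integral times, `u = 1` is one). -/
structure IsTimeUnit (I : MSRInstance J PM PR) (u : ℝ) : Prop where
  pos : 0 < u
  le_pMap : ∀ i j k, I.pMap i j k ≠ 0 → u ≤ I.pMap i j k
  le_pReduce : ∀ i j r, I.pReduce i j r ≠ 0 → u ≤ I.pReduce i j r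
  le_transfer : ∀ j r k, I.transfer j r k ≠ 0 → u ≤ I.transfer j r k

/-- The modified Map-Reduce instance: the processing time of every Reduce task is increased, on
every processor, by the total transfer time of its Shuffle tasks. -/
def shuffleReduce (I : MSRInstance J PM PR) : MRInstance J PM PR where
  w := I.w
  numMap := I.numMap
  numReduce := I.numReduce
  pMap := I.pMap
  pReduce := fun i j r => I.pReduce i j r + ∑ k, I.transfer j r k
  w_pos := I.w_pos
  numMap_pos := I.numMap_pos
  numReduce_pos := I.numReduce_pos
  pMap_nonneg := I.pMap_nonneg
  pReduce_nonneg := fun i j r =>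
    add_nonneg (I.pReduce_nonneg i j r) (Finset.sum_nonneg fun k _ => I.transfer_nonneg j r k)

variable [Fintype J] [Fintype PM] [Fintype PR] [Nonempty PM] [Nonempty PR]

/-- A run of MRS on a Map-Shuffle-Reduce instance: a run of MRS on the modified instance, and for
every Reduce task an (arbitrary) order of its Shuffle tasks. -/
structure MRSRun (I : MSRInstance J PM PR) (u : ℝ) where
  run : I.shuffleReduce.MRSRun u
  order : (j : J) → Fin (I.numReduce j) → Fin (I.numMap j) → ℕ
  order_injective : ∀ j r, Function.Injective (order j r)

/-- The schedule computed by MRS for the Map-Shuffle-Reduce problem: in the time that the schedule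
of the modified instance reserves for a Reduce task, its Shuffle tasks are executed first, one
directly after the other, and then the Reduce task itself. -/
def MRSRun.schedule {I : MSRInstance J PM PR} {u : ℝ} (A : I.MRSRun u) : MSRSchedule I where
  mapProc := A.run.schedule.mapProc
  mapStart := A.run.schedule.mapStart
  reduceProc := A.run.schedule.reduceProc
  reduceStart := fun r =>
    A.run.schedule.reduceStart r + ∑ k, I.transfer r.1 r.2 k
  shuffleStart := fun h =>
    A.run.schedule.reduceStart ⟨h.1, h.2.1⟩ +
      ∑ k ∈ Finset.univ.filter (fun k => A.order h.1 h.2.1 k < A.order h.1 h.2.1 h.2.2),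
        I.transfer h.1 h.2.1 k

end MSRInstance

end MapReduce

namespace MapReduce

/-! ## Orders, slots and matchings -/

/-! Two lower bounds on the optimum, one per stage, are each charged once. In a feasible schedule of
the original problem the Map tasks alone, and the Reduce tasks with their Shuffle times absorbed,
give integral solutions of the two linear programs in which the dummy completion times are the job
completion times (`exists_mapStage_LPFeasible`, `exists_reduceStage_LPFeasible`). So each LP optimum
is at most the cost of that schedule.

TaskScheduling finishes a task of LP completion time `C` by `27/2 * C` (`finish_le_of_mem_active`).
By a Markov argument a third of each task is assigned up to its class, so scaling by `a/(a-1) = 3`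
gives full fractional assignments. The Shmoys–Tardos matching exists by Hall's theorem
(`exists_slot_matching`). It loads a processor with at most one longest task of the class plus the
fractional load (`sum_le_of_slots`). Over the classes up to `n` the longest tasks form a geometric
sum, at most `3 u (3/2)^n`, and the scaled LP load is at most as much again. The total is `6 u
(3/2)^n = 9 u (3/2)^(n-1)`, and `u (3/2)^(n-1) ≤ 3/2 * C`.

In the merge, the tasks on a processor whose jobs have width at most `ω` all finish by `ω` in the
separate schedule, so they have total length at most `ω`. Hence Map tasks finish by the width of
their job, and Reduce tasks, released at the width, finish by twice the width. With width at most
`27/2 * (D_M + D_R)`, each job finishes by `27 * (D_M + D_R)`, and summing with weights gives `27 +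
27 = 54`. Precedence holds because Reduce work of a job starts only at its width. Existence of LP
optima comes from compactness after truncating solutions to a box. -/

/-- A finite type can be enumerated in such a way that a given function is monotone. -/
theorem exists_injective_strictMono {T α : Type*} [Fintype T] [LinearOrder α] (f : T → α) :
    ∃ o : T → ℕ, Function.Injective o ∧ ∀ a b, f a < f b → o a < o b := by
  classical
  let e := Fintype.equivFin T
  -- Ties of `f` are broken by an arbitrary enumeration; the position of an element is the number of
  -- elements below it.
  let g : T → α ×ₗ Fin (Fintype.card T) := fun k => toLex (f k, e k)
  have hg : Function.Injective g := by
    intro a b h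
    have h2 : (f a, e a) = (f b, e b) := toLex.injective h
    exact e.injective (Prod.ext_iff.1 h2).2
  have key : ∀ a b, g a < g b →
      (Finset.univ.filter (fun k => g k < g a)).card <
        (Finset.univ.filter (fun k => g k < g b)).card := by
    intro a b h
    apply Finset.card_lt_card
    rw [Finset.ssubset_iff_of_subset]
    · exact ⟨a, by simpa using h, by simp⟩
    · intro k hk
      simp only [Finset.mem_filter, Finset.mem_univ, true_and] at hk ⊢
      exact hk.trans h
  refine ⟨fun k => (Finset.univ.filter (fun k' => g k' < g k)).card, ?_, ?_⟩
  · intro a b h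
    rcases lt_trichotomy (g a) (g b) with h1 | h1 | h1
    · exact absurd h (key _ _ h1).ne
    · exact hg h1
    · exact absurd h (key _ _ h1).ne'
  · intro a b h
    exact key _ _ (Prod.Lex.toLex_lt_toLex.2 (Or.inl h))

/-- The length of `[0, t) ∩ [s, s + 1)`. -/
noncomputable def unitSlot (s : ℕ) (t : ℝ) : ℝ := max 0 (min (t - s) 1)

theorem unitSlot_le_one (s : ℕ) (t : ℝ) : unitSlot s t ≤ 1 :=
  max_le zero_le_one (min_le_right _ _)

theorem unitSlot_mono (s : ℕ) : Monotone (unitSlot s) := fun a b h =>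
  max_le_max le_rfl (min_le_min (by linarith) le_rfl)

theorem unitSlot_eq_one {s : ℕ} {t : ℝ} (h : (s : ℝ) + 1 ≤ t) : unitSlot s t = 1 := by
  unfold unitSlot
  rw [min_eq_right (by linarith), max_eq_right zero_le_one]

theorem unitSlot_eq_zero {s : ℕ} {t : ℝ} (h : t ≤ s) : unitSlot s t = 0 := by
  unfold unitSlot
  rw [max_eq_left]
  exact (min_le_left _ _).trans (by linarith)

theorem unitSlot_zero (s : ℕ) : unitSlot s 0 = 0 := unitSlot_eq_zero (Nat.cast_nonneg s)

theorem sum_unitSlot {t : ℝ} (ht : 0 ≤ t) (N : ℕ) :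
    ∑ s ∈ Finset.range N, unitSlot s t = min t N := by
  induction N with
  | zero => simp [ht]
  | succ N ih =>
    rw [Finset.sum_range_succ, ih]
    push_cast
    rcases le_total t N with h | h
    · rw [unitSlot_eq_zero h, min_eq_left h, min_eq_left (by linarith), add_zero]
    · rw [min_eq_right h]
      unfold unitSlot
      rw [max_eq_right (le_min (by linarith) zero_le_one)]
      rw [← min_add_add_left]
      congr 1
      ring

theorem sum_range_unitSlot_sub {b y : ℝ} (hb : 0 ≤ b) (hy : 0 ≤ y) {N : ℕ} (hN : b + y ≤ N) :
    ∑ s ∈ Finset.range N, (unitSlot s (b + y) - unitSlot s b) = y := by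
  rw [Finset.sum_sub_distrib, sum_unitSlot (by linarith), sum_unitSlot hb,
    min_eq_left hN, min_eq_left (by linarith)]
  ring

theorem sum_range_unitSlot_sub_le {b y : ℝ} (hb : 0 ≤ b) (hy : 0 ≤ y) (N : ℕ) :
    ∑ s ∈ Finset.range N, (unitSlot s (b + y) - unitSlot s b) ≤ y := by
  rw [Finset.sum_sub_distrib, sum_unitSlot (by linarith), sum_unitSlot hb]
  rcases le_total b N with h | h
  · rw [min_eq_left h]
    linarith [min_le_left (b + y) (N : ℝ)]
  · rw [min_eq_right h]
    linarith [min_le_right (b + y) (N : ℝ)]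

/-- Consecutive intervals of lengths `y k`, lined up in the order `o`, telescope. -/
theorem sum_telescope {T : Type*} (A : Finset T) {o : T → ℕ} (ho : Function.Injective o)
    (y : T → ℝ) (g : ℝ → ℝ) :
    ∑ k ∈ A, (g (∑ k' ∈ A with o k' < o k, y k' + y k) - g (∑ k' ∈ A with o k' < o k, y k')) =
      g (∑ k ∈ A, y k) - g 0 := by
  classical
  -- The element added is the last one in the order `o`, so the prefix sums of all others are
  -- unchanged.
  induction A using Finset.induction_on_max_value o with
  | empty => simp
  | insert a A ha hmax ih =>
    rw [Finset.sum_insert ha, Finset.sum_insert ha]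
    have h1 : (insert a A).filter (fun k' => o k' < o a) = A := by
      ext k
      simp only [Finset.mem_filter, Finset.mem_insert]
      constructor
      · rintro ⟨rfl | h, h2⟩
        · exact absurd h2 (lt_irrefl _)
        · exact h
      · intro h
        exact ⟨Or.inr h, lt_of_le_of_ne (hmax k h) (fun h2 => ha (ho h2 ▸ h))⟩
    have h2 : ∀ k ∈ A, (insert a A).filter (fun k' => o k' < o k) =
        A.filter (fun k' => o k' < o k) := by
      intro k hk
      rw [Finset.filter_insert, if_neg (not_lt.2 (hmax k hk))]
    have h3 : ∑ k ∈ A, (g (∑ k' ∈ insert a A with o k' < o k, y k' + y k) -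
        g (∑ k' ∈ insert a A with o k' < o k, y k')) = g (∑ k ∈ A, y k) - g 0 := by
      rw [← ih]
      exact Finset.sum_congr rfl fun k hk => by rw [h2 k hk]
    rw [h1, h3, add_comm (y a)]
    ring

/-- The load bound of the rounding of Shmoys and Tardos, on one processor. -/
theorem sum_le_of_slots {T : Type*} (A B : Finset T) (hBA : B ⊆ A) {o : T → ℕ}
    (ho : Function.Injective o) (y p : T → ℝ) (hy : ∀ k ∈ A, 0 ≤ y k) (hp : ∀ k ∈ A, 0 ≤ p k)
    (hsort : ∀ a b, o a < o b → p b ≤ p a) (slot : T → ℕ)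
    (hinj : Set.InjOn slot B)
    (hlow : ∀ k ∈ B, (slot k : ℝ) < ∑ k' ∈ A with o k' < o k, y k' + y k)
    {M : ℝ} (hM : 0 ≤ M) (hpM : ∀ k ∈ B, p k ≤ M) :
    ∑ k ∈ B, p k ≤ M + ∑ k ∈ A, p k * y k := by
  classical
  set b : T → ℝ := fun k => ∑ k' ∈ A with o k' < o k, y k' with hb
  have hb0 : ∀ k, 0 ≤ b k := fun k =>
    Finset.sum_nonneg fun k' hk' => hy k' (Finset.mem_filter.1 hk').1
  set x : ℕ → T → ℝ := fun s k => unitSlot s (b k + y k) - unitSlot s (b k) with hx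
  have hx0 : ∀ s, ∀ k ∈ A, 0 ≤ x s k := fun s k hk =>
    sub_nonneg.2 (unitSlot_mono s (by linarith [hy k hk]))
  -- The budget of a slot: slot `0` gets `M`, and slot `s + 1` gets the fractional load lying in the
  -- preceding slot `s`.
  let F : ℕ → ℝ := fun n => Nat.casesOn n M (fun s => ∑ k ∈ A, p k * x s k)
  have hF0 : ∀ n, 0 ≤ F n := by
    intro n
    cases n with
    | zero => exact hM
    | succ s => exact Finset.sum_nonneg fun k hk => mul_nonneg (hp k hk) (hx0 s k hk)
  have hle : ∀ k ∈ B, p k ≤ F (slot k) := by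
    intro k hk
    have hl := hlow k hk
    rcases h : slot k with _ | s
    · exact hpM k hk
    · rw [h] at hl
      push_cast at hl
      have htot : ∑ k' ∈ A with o k' < o k, y k' + y k ≤ ∑ k' ∈ A, y k' := by
        rw [← Finset.sum_filter_add_sum_filter_not A (fun k' => o k' < o k)]
        gcongr
        refine Finset.single_le_sum (f := y) (fun k' hk' => hy k' (Finset.mem_filter.1 hk').1) ?_
        simp [hBA hk]
      -- Since `k` reaches into slot `s + 1`, slot `s` is completely filled. Tasks behind `k` begin
      -- after its end, so slot `s` contains only tasks at least as long as `k`, and their average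
      -- length is at least `p k`.
      have h1 : ∑ k' ∈ A, x s k' = 1 := by
        rw [hx, hb, sum_telescope A ho y (unitSlot s), unitSlot_zero, unitSlot_eq_one (by linarith)]
        ring
      calc p k = ∑ k' ∈ A, p k * x s k' := by rw [← Finset.mul_sum, h1, mul_one]
        _ ≤ ∑ k' ∈ A, p k' * x s k' := by
          refine Finset.sum_le_sum fun k' hk' => ?_
          rcases lt_trichotomy (o k') (o k) with h2 | h2 | h2
          · exact mul_le_mul_of_nonneg_right (hsort _ _ h2) (hx0 s k' hk')
          · rw [ho h2]
          · have h3 : b k + y k ≤ b k' := by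
              have h4 : insert k (A.filter (fun a => o a < o k)) ⊆
                  A.filter (fun a => o a < o k') := by
                intro a ha
                rcases Finset.mem_insert.1 ha with rfl | ha
                · simp [hBA hk, h2]
                · rw [Finset.mem_filter] at ha ⊢
                  exact ⟨ha.1, ha.2.trans h2⟩
              have h5 := Finset.sum_le_sum_of_subset_of_nonneg (f := y) h4
                (fun a ha _ => hy a (Finset.mem_filter.1 ha).1)
              rw [Finset.sum_insert (by simp)] at h5
              linarith
            have h6 : x s k' = 0 := by
              have h7 := hy k' hk'
              rw [hx]
              dsimp only
              rw [unitSlot_eq_one (by linarith), unitSlot_eq_one (by linarith), sub_self]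
            rw [h6, mul_zero, mul_zero]
  obtain ⟨N, hN⟩ := (B.image slot).exists_nat_subset_range
  calc ∑ k ∈ B, p k ≤ ∑ k ∈ B, F (slot k) := Finset.sum_le_sum hle
    _ = ∑ s ∈ B.image slot, F s := (Finset.sum_image hinj).symm
    _ ≤ ∑ s ∈ Finset.range (N + 1), F s :=
      Finset.sum_le_sum_of_subset_of_nonneg
        (hN.trans (Finset.range_mono (Nat.le_succ N))) (fun s _ _ => hF0 s)
    _ = M + ∑ k ∈ A, p k * ∑ s ∈ Finset.range N, x s k := by
      rw [Finset.sum_range_succ', add_comm]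
      congr 1
      change ∑ s ∈ Finset.range N, ∑ k ∈ A, p k * x s k = _
      rw [Finset.sum_comm]
      simp_rw [Finset.mul_sum]
    _ ≤ M + ∑ k ∈ A, p k * y k := by
      gcongr with k hk
      · exact hp k hk
      · exact sum_range_unitSlot_sub_le (hb0 k) (hy k hk) N

/-- The matching of the rounding of Shmoys and Tardos exists. -/
theorem exists_slot_matching {T P : Type*} [Fintype P] [Nonempty P] (A : Finset T) (c : T → ℕ)
    (o : P → T → ℕ) (ho : ∀ i, Function.Injective (o i)) (y : P → T → ℝ)
    (hy : ∀ i, ∀ k ∈ A, 0 ≤ y i k) (hsum : ∀ k ∈ A, 1 ≤ ∑ i, y i k) :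
    ∃ (proc : T → P) (slot : T → ℕ),
      (∀ k ∈ A, 0 < y (proc k) k ∧
        ∑ k' ∈ A with c k' = c k ∧ o (proc k) k' < o (proc k) k, y (proc k) k' < slot k + 1 ∧
        (slot k : ℝ) <
          ∑ k' ∈ A with c k' = c k ∧ o (proc k) k' < o (proc k) k, y (proc k) k' +
            y (proc k) k) ∧
      ∀ k ∈ A, ∀ k' ∈ A, c k = c k' → proc k = proc k' → slot k = slot k' → k = k' := by
  classical
  set b : P → T → ℝ := fun i k => ∑ k' ∈ A with c k' = c k ∧ o i k' < o i k, y i k' with hb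
  have hb0 : ∀ i k, 0 ≤ b i k := fun i k =>
    Finset.sum_nonneg fun k' hk' => hy i k' (Finset.mem_filter.1 hk').1
  set x : P → ℕ → T → ℝ := fun i s k => unitSlot s (b i k + y i k) - unitSlot s (b i k) with hx
  have hx0 : ∀ i s, ∀ k ∈ A, 0 ≤ x i s k := fun i s k hk =>
    sub_nonneg.2 (unitSlot_mono s (by linarith [hy i k hk]))
  obtain ⟨N, hN⟩ := exists_nat_ge (∑ i, ∑ k ∈ A, y i k)
  have hbN : ∀ i, ∀ k ∈ A, b i k + y i k ≤ N := by
    intro i k hk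
    have h1 : b i k + y i k ≤ ∑ k ∈ A, y i k := by
      rw [← Finset.sum_filter_add_sum_filter_not A (fun k' => c k' = c k ∧ o i k' < o i k)]
      gcongr
      refine Finset.single_le_sum (f := y i) (fun k' hk' => hy i k' (Finset.mem_filter.1 hk').1) ?_
      simp [hk]
    refine h1.trans (le_trans ?_ hN)
    exact Finset.single_le_sum (f := fun i => ∑ k ∈ A, y i k)
      (fun i _ => Finset.sum_nonneg fun k hk => hy i k hk) (Finset.mem_univ i)
  -- The matching is sought for all classes at once: a slot is a triple of class, processor and
  -- number, and `v k z` is the length that task `k` occupies in it.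
  let v : T → ℕ × P × ℕ → ℝ := fun k z => if z.1 = c k then x z.2.1 z.2.2 k else 0
  have hv0 : ∀ k ∈ A, ∀ z, 0 ≤ v k z := by
    intro k hk z
    dsimp only [v]
    split_ifs
    · exact hx0 _ _ k hk
    · exact le_rfl
  let full : T → Finset (ℕ × P × ℕ) := fun k => {c k} ×ˢ Finset.univ ×ˢ Finset.range N
  let t : A → Finset (ℕ × P × ℕ) := fun k => (full k).filter (fun z => v k z ≠ 0)
  have hone : ∀ k ∈ A, ∑ z ∈ full k, v k z = ∑ i, y i k := by
    intro k hk
    rw [Finset.sum_product, Finset.sum_singleton, Finset.sum_product]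
    refine Finset.sum_congr rfl fun i _ => ?_
    simp only [v, if_true]
    exact sum_range_unitSlot_sub (hb0 i k) (hy i k hk) (hbN i k hk)
  have hslot : ∀ z : ℕ × P × ℕ, ∑ k ∈ A, v k z ≤ 1 := by
    rintro ⟨l, i, s⟩
    dsimp only [v]
    simp_rw [eq_comm (a := l)]
    rw [← Finset.sum_filter]
    have h1 := sum_telescope (A.filter (fun k => c k = l)) (ho i) (y i) (unitSlot s)
    have h2 : ∀ k ∈ A.filter (fun k => c k = l),
        x i s k = (unitSlot s
          (∑ k' ∈ A.filter (fun k => c k = l) with o i k' < o i k, y i k' + y i k) -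
          unitSlot s (∑ k' ∈ A.filter (fun k => c k = l) with o i k' < o i k, y i k')) := by
      intro k hk
      rw [Finset.mem_filter] at hk
      rw [Finset.filter_filter, ← hk.2]
    rw [Finset.sum_congr rfl h2, h1, unitSlot_zero]
    linarith [unitSlot_le_one s (∑ k ∈ A with c k = l, y i k)]
  -- Hall's condition by double counting: `v` is a fractional matching giving each task total at
  -- least one and each slot total at most one.
  have hall : ∀ X : Finset A, X.card ≤ (X.biUnion t).card := by
    intro X
    have h1 : (X.card : ℝ) ≤ ∑ k ∈ X, ∑ z ∈ X.biUnion t, v k z := by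
      rw [Finset.card_eq_sum_ones]
      push_cast
      refine Finset.sum_le_sum fun k hk => ?_
      calc (1 : ℝ) ≤ ∑ i, y i k := hsum k k.2
        _ = ∑ z ∈ t k, v k z := by rw [Finset.sum_filter_ne_zero, hone k k.2]
        _ ≤ _ := Finset.sum_le_sum_of_subset_of_nonneg (Finset.subset_biUnion_of_mem t hk)
          (fun z _ _ => hv0 k k.2 z)
    have h2 : ∑ k ∈ X, ∑ z ∈ X.biUnion t, v k z ≤ ((X.biUnion t).card : ℝ) := by
      rw [Finset.sum_comm, Finset.card_eq_sum_ones]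
      push_cast
      refine Finset.sum_le_sum fun z _ => le_trans ?_ (hslot z)
      rw [← Finset.sum_coe_sort A]
      exact Finset.sum_le_sum_of_subset_of_nonneg (Finset.subset_univ X)
        (fun k _ _ => hv0 k k.2 z)
    exact_mod_cast h1.trans h2
  obtain ⟨f, hf, hft⟩ := (Finset.all_card_le_biUnion_card_iff_exists_injective t).1 hall
  have hfx : ∀ k : A, (f k).1 = c k ∧ x (f k).2.1 (f k).2.2 k ≠ 0 := by
    intro k
    have h1 := (Finset.mem_filter.1 (hft k))
    have h2 : (f k).1 = c k := by simpa using (Finset.mem_product.1 h1.1).1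
    refine ⟨h2, ?_⟩
    have h3 := h1.2
    simpa only [v, h2, if_true] using h3
  refine ⟨fun k => if h : k ∈ A then (f ⟨k, h⟩).2.1 else Classical.arbitrary P,
    fun k => if h : k ∈ A then (f ⟨k, h⟩).2.2 else 0, ?_, ?_⟩
  · intro k hk
    simp only [hk, dif_pos]
    have h1 := (hfx ⟨k, hk⟩).2
    set i := (f ⟨k, hk⟩).2.1
    set s := (f ⟨k, hk⟩).2.2
    have h0 := hy i k hk
    refine ⟨lt_of_le_of_ne h0 fun h => h1 ?_, lt_of_not_ge fun h => h1 ?_,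
      lt_of_not_ge fun h => h1 ?_⟩
    · simp [hx, ← h]
    · change (s : ℝ) + 1 ≤ b i k at h
      simp only [hx]
      rw [unitSlot_eq_one h, unitSlot_eq_one (by linarith), sub_self]
    · change b i k + y i k ≤ s at h
      simp only [hx]
      rw [unitSlot_eq_zero h, unitSlot_eq_zero (by linarith), sub_self]
  · intro k hk k' hk' hc hp hs
    simp only [hk, hk', dif_pos] at hp hs
    have : f ⟨k, hk⟩ = f ⟨k', hk'⟩ := by
      refine Prod.ext ?_ (Prod.ext hp hs)
      rw [(hfx ⟨k, hk⟩).1, (hfx ⟨k', hk'⟩).1]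
      exact hc
    exact congrArg Subtype.val (hf this)

/-! ## Load of a processor, and the dispatching rule -/

/-- Non-overlapping tasks that are executed within `[0, W]` have total length at most `W`. -/
theorem NonOverlapping.sum_le {T P : Type*} {proc : T → P} {start finish : T → ℝ}
    (h : NonOverlapping proc start finish) (hstart : ∀ a, 0 ≤ start a)
    (hle : ∀ a, start a ≤ finish a) (i : P) {W : ℝ} (hW : 0 ≤ W) (A : Finset T)
    (hA : ∀ a ∈ A, proc a = i ∧ finish a ≤ W) :
    ∑ a ∈ A, (finish a - start a) ≤ W := by
  classical
  -- Tasks of length zero are left out: positive length of the task that starts last excludes that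
  -- it finishes before another one starts, so all others finish by its start.
  have key : ∀ (B : Finset T) (W : ℝ), 0 ≤ W →
      (∀ a ∈ B, proc a = i ∧ finish a ≤ W ∧ start a < finish a) →
      ∑ a ∈ B, (finish a - start a) ≤ W := by
    intro B
    induction B using Finset.induction_on_max_value start with
    | empty => intro W hW _; simpa using hW
    | insert a B ha hmax ih =>
      intro W hW hB
      rw [Finset.sum_insert ha]
      obtain ⟨h1, h2, h3⟩ := hB a (Finset.mem_insert_self a B)
      have h4 := ih (start a) (hstart a) (fun b hb => by
        obtain ⟨h5, h6, h7⟩ := hB b (Finset.mem_insert_of_mem hb)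
        refine ⟨h5, ?_, h7⟩
        rcases h a b (fun hab => ha (hab ▸ hb)) (h1.trans h5.symm) with h8 | h8
        · linarith [hmax b hb]
        · exact h8)
      linarith
  have h1 : ∑ a ∈ A with start a < finish a, (finish a - start a) =
      ∑ a ∈ A, (finish a - start a) := by
    refine Finset.sum_filter_of_ne fun a _ hne => lt_of_le_of_ne (hle a) fun h2 => hne ?_
    rw [h2, sub_self]
  rw [← h1]
  refine key _ W hW fun a ha => ?_
  rw [Finset.mem_filter] at ha
  exact ⟨(hA a ha.1).1, (hA a ha.1).2, ha.2⟩

namespace Dispatch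

variable {T : Type*} {p r ω start : T → ℝ} {t : ℝ} {R : Set T}

theorem congr {start' : T → ℝ} (h : Dispatch p r ω start t R)
    (hs : ∀ k ∈ R, start' k = start k) : Dispatch p r ω start' t R := by
  induction h with
  | done t => exact .done t
  | run t R k mem released smallest starts rest ih =>
    exact .run t R k mem released smallest ((hs k mem).trans starts)
      (ih fun k' hk' => hs k' hk'.1)
  | wait t t' R later next rest ih => exact .wait t t' R later next (ih hs)

/-- Induction on the number of unscheduled tasks. Waiting does not lower this number, but it leads
to a time at which some task is released, so the case of a released task is settled first and used
for both. -/
theorem exists_start (p r ω : T → ℝ) (t : ℝ) (R : Finset T) :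
    ∃ start, Dispatch p r ω start t (R : Set T) := by
  classical
  induction hn : R.card generalizing t R with
  | zero =>
    rw [Finset.card_eq_zero] at hn
    subst hn
    exact ⟨0, by simpa using Dispatch.done t⟩
  | succ n ih =>
    have hne : R.Nonempty := Finset.card_pos.1 (by omega)
    have released : ∀ t, (∃ k ∈ R, r k ≤ t) → ∃ start, Dispatch p r ω start t (R : Set T) := by
      rintro t ⟨k₀, hk₀, hr₀⟩
      obtain ⟨k, hk, hmin⟩ := (R.filter (fun k => r k ≤ t)).exists_min_image ω
        ⟨k₀, Finset.mem_filter.2 ⟨hk₀, hr₀⟩⟩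
      rw [Finset.mem_filter] at hk
      obtain ⟨start, hstart⟩ := ih (t + p k) (R.erase k)
        (by rw [Finset.card_erase_of_mem hk.1, hn]; rfl)
      rw [Finset.coe_erase] at hstart
      refine ⟨Function.update start k t, .run t _ k hk.1 hk.2
        (fun k' h1 h2 => hmin k' (Finset.mem_filter.2 ⟨h1, h2⟩)) (by simp) (hstart.congr ?_)⟩
      intro k' hk'
      exact Function.update_of_ne hk'.2 _ _
    by_cases h : ∃ k ∈ R, r k ≤ t
    · exact released t h
    · push Not at h
      obtain ⟨k, hk, hmin⟩ := R.exists_min_image r hne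
      obtain ⟨start, hstart⟩ := released (r k) ⟨k, hk, le_rfl⟩
      refine ⟨start, .wait t (r k) _ (h k hk) ⟨⟨k, hk, rfl⟩, ?_⟩ hstart⟩
      rintro _ ⟨k', hk', rfl⟩
      exact hmin k' hk'

theorem le_start (h : Dispatch p r ω start t R) (hp : ∀ k, 0 ≤ p k) :
    ∀ k ∈ R, t ≤ start k ∧ r k ≤ start k := by
  induction h with
  | done t => exact fun k hk => hk.elim
  | run t R k mem released smallest starts rest ih =>
    intro k' hk'
    by_cases hkk : k' = k
    · subst hkk
      exact ⟨starts.ge, starts ▸ released⟩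
    · have h1 := ih k' ⟨hk', hkk⟩
      exact ⟨by linarith [hp k, h1.1], h1.2⟩
  | wait t t' R later next rest ih =>
    intro k hk
    exact ⟨later.le.trans (ih k hk).1, (ih k hk).2⟩

theorem nonOverlapping (h : Dispatch p r ω start t R) (hp : ∀ k, 0 ≤ p k) :
    ∀ a ∈ R, ∀ b ∈ R, a ≠ b → start a + p a ≤ start b ∨ start b + p b ≤ start a := by
  induction h with
  | done t => exact fun k hk => hk.elim
  | run t R k mem released smallest starts rest ih =>
    intro a ha b hb hab
    by_cases hak : a = k
    · subst hak
      left
      rw [starts]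
      exact (rest.le_start hp b ⟨hb, hab.symm⟩).1
    · by_cases hbk : b = k
      · subst hbk
        right
        rw [starts]
        exact (rest.le_start hp a ⟨ha, hab⟩).1
      · exact ih a ⟨ha, hak⟩ b ⟨hb, hbk⟩ hab
  | wait t t' R later next rest ih => exact ih

open Classical in
/-- If the release times are non-decreasing in `ω`, then from its release on a task waits only
for tasks that are not larger with respect to `ω`. -/
theorem finish_le [Fintype T] (h : Dispatch p r ω start t R) (hp : ∀ k, 0 ≤ p k)
    (hr : ∀ a b, ω a ≤ ω b → r a ≤ r b) :
    ∀ k ∈ R, start k + p k ≤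
      max t (r k) + ∑ k' ∈ Finset.univ.filter (fun k' => k' ∈ R ∧ ω k' ≤ ω k), p k' := by
  induction h with
  | done t => exact fun k hk => hk.elim
  | run t R k mem released smallest starts rest ih =>
    intro k' hk'
    by_cases hkk : k' = k
    · subst hkk
      have h1 := Finset.single_le_sum (f := p) (fun a _ => hp a)
        (Finset.mem_filter.2 ⟨Finset.mem_univ k', hk', le_rfl⟩ :
          k' ∈ Finset.univ.filter (fun a => a ∈ R ∧ ω a ≤ ω k'))
      rw [starts]
      linarith [le_max_left t (r k')]
    · have h1 := ih k' ⟨hk', hkk⟩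
      -- Were `ω k'` smaller, `k'` would be released no later than `k`, and the rule would not have
      -- chosen `k`.
      have h2 : ω k ≤ ω k' := by
        by_contra h3
        push Not at h3
        exact absurd (smallest k' hk' ((hr _ _ h3.le).trans released)) (not_le.2 h3)
      have h3 : Finset.univ.filter (fun a => a ∈ R ∧ ω a ≤ ω k') =
          insert k (Finset.univ.filter (fun a => a ∈ R \ {k} ∧ ω a ≤ ω k')) := by
        ext a
        simp only [Finset.mem_filter, Finset.mem_univ, true_and, Finset.mem_insert,
          Set.mem_sdiff, Set.mem_singleton_iff]
        by_cases hak : a = k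
        · subst hak; simp [mem, h2]
        · simp [hak]
      rw [h3, Finset.sum_insert (by simp)]
      have h4 : max (t + p k) (r k') ≤ max t (r k') + p k :=
        max_le (by linarith [le_max_left t (r k')])
          (by linarith [le_max_right t (r k'), hp k])
      refine (h1.trans (add_le_add h4 le_rfl)).trans (le_of_eq ?_)
      rw [add_assoc]
      congr!
  | wait t t' R later next rest ih =>
    intro k hk
    have h1 := ih k hk
    -- Waiting costs nothing: no remaining task is released before `t'`, so both maxima equal `r k`.
    rwa [max_eq_right (next.2 ⟨k, hk, rfl⟩), ← max_eq_right (later.le.trans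
      (next.2 ⟨k, hk, rfl⟩))] at h1

end Dispatch

end MapReduce

namespace MapReduce

namespace Stage

/-! ### The geometric intervals -/

theorem one_add_delta : 1 + delta = 3 / 2 := by unfold delta; norm_num

/-- The last interval is taken to be unbounded above, since completion times of arbitrary schedules
may exceed the horizon. -/
theorem exists_level {u c : ℝ} (hc : u ≤ c) {L : ℕ} (hL : 1 ≤ L) :
    ∃ l ∈ Finset.Icc 1 L, u * (1 + delta) ^ (l - 1) ≤ c ∧
      (c ≤ u * (1 + delta) ^ l ∨ l = L) := by
  induction L, hL using Nat.le_induction with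
  | base => exact ⟨1, by simp, by simpa using hc, Or.inr rfl⟩
  | succ L hL ih =>
    obtain ⟨l, hl, h1, h2⟩ := ih
    rw [Finset.mem_Icc] at hl
    by_cases h3 : c ≤ u * (1 + delta) ^ l
    · exact ⟨l, Finset.mem_Icc.2 ⟨hl.1, by omega⟩, h1, Or.inl h3⟩
    · have h4 := h2.resolve_left h3
      subst h4
      exact ⟨l + 1, Finset.mem_Icc.2 ⟨by omega, le_rfl⟩, (not_le.1 h3).le, Or.inr rfl⟩

theorem mul_pow_le_mul_pow {u : ℝ} (hu : 0 ≤ u) {m n : ℕ} (h : m ≤ n) :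
    u * (1 + delta) ^ m ≤ u * (1 + delta) ^ n :=
  mul_le_mul_of_nonneg_left (pow_le_pow_right₀ (by rw [one_add_delta]; norm_num) h) hu

theorem mul_pow_nonneg {u : ℝ} (hu : 0 ≤ u) (n : ℕ) : 0 ≤ u * (1 + delta) ^ n :=
  mul_nonneg hu (pow_nonneg (by rw [one_add_delta]; norm_num) n)

/-- The factor is `(1 + δ) / δ = 3`, from the geometric series. -/
theorem sum_pow_le {u : ℝ} (hu : 0 ≤ u) (n : ℕ) :
    ∑ l ∈ Finset.Icc 1 n, u * (1 + delta) ^ l ≤ 3 * (u * (1 + delta) ^ n) := by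
  induction n with
  | zero => simpa using hu
  | succ n ih =>
    rw [Finset.sum_Icc_succ_top (by omega), pow_succ, one_add_delta] at *
    linarith

theorem mem_active {J T P : Type*} [Fintype T] {S : Stage J T P} {k : T} :
    k ∈ S.active ↔ ∀ i, 0 < S.p i k := by
  simp [active]

variable {J T P : Type*} [Fintype T] [Fintype P] [Nonempty P] {S : Stage J T P} {u : ℝ}

theorem sum_active_le_tMax (S : Stage J T P) (i : P) : ∑ k ∈ S.active, S.p i k ≤ S.tMax :=
  Finset.sum_le_sum fun k _ => Finset.le_sup' (fun i => S.p i k) (Finset.mem_univ i)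

theorem p_le_tMax {k : T} (hk : k ∈ S.active) (i : P) : S.p i k ≤ S.tMax :=
  (Finset.single_le_sum (f := fun k => S.p i k) (fun _ h => (mem_active.1 h i).le) hk).trans
    (S.sum_active_le_tMax i)

theorem tMax_nonneg (S : Stage J T P) : 0 ≤ S.tMax :=
  (Finset.sum_nonneg fun _ h => (mem_active.1 h (Classical.arbitrary P)).le).trans
    (S.sum_active_le_tMax (Classical.arbitrary P))

theorem numIntervals_spec (S : Stage J T P) (hu : 0 < u) :
    1 ≤ S.numIntervals u ∧ S.tMax ≤ u * (1 + delta) ^ (S.numIntervals u - 1) := by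
  have hne : {L : ℕ | 1 ≤ L ∧ S.tMax ≤ u * (1 + delta) ^ (L - 1)}.Nonempty := by
    obtain ⟨n, hn⟩ := pow_unbounded_of_one_lt (S.tMax / u)
      (show (1 : ℝ) < 1 + delta by rw [one_add_delta]; norm_num)
    refine ⟨n + 1, by omega, ?_⟩
    rw [div_lt_iff₀ hu, mul_comm] at hn
    simpa using hn.le
  exact Nat.sInf_mem hne

/-! ### The linear program -/

/-- Every schedule yields a feasible solution of the linear program. -/
theorem exists_LPFeasible (hu : 0 < u) (hunit : ∀ k ∈ S.active, ∀ i, u ≤ S.p i k)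
    (q : T → P) (c : T → ℝ) (D : J → ℝ) (hD : ∀ j, 0 ≤ D j)
    (hcD : ∀ k ∈ S.active, c k ≤ D (S.job k)) (hc : ∀ k ∈ S.active, S.p (q k) k ≤ c k)
    (hload : ∀ i W, 0 ≤ W → ∀ B ⊆ S.active, (∀ k ∈ B, q k = i ∧ c k ≤ W) →
      ∑ k ∈ B, S.p i k ≤ W) :
    ∃ y, S.LPFeasible u y c D := by
  classical
  obtain ⟨hL, htL⟩ := S.numIntervals_spec hu
  set L := S.numIntervals u with hLdef
  have hlev : ∀ k, ∃ l, k ∈ S.active → l ∈ Finset.Icc 1 L ∧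
      u * (1 + delta) ^ (l - 1) ≤ c k ∧ (c k ≤ u * (1 + delta) ^ l ∨ l = L) := by
    intro k
    by_cases hk : k ∈ S.active
    · obtain ⟨l, h1, h2⟩ := exists_level ((hunit k hk (q k)).trans (hc k hk)) hL
      exact ⟨l, fun _ => ⟨h1, h2⟩⟩
    · exact ⟨0, fun h => absurd h hk⟩
  choose lv hlv using hlev
  have hsum : ∀ (f : ℕ → ℝ), ∀ k ∈ S.active,
      ∑ i, ∑ l ∈ Finset.Icc 1 L, f l * (if q k = i ∧ lv k = l then (1 : ℝ) else 0) = f (lv k) := by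
    intro f k hk
    rw [Finset.sum_eq_single (q k) (fun i _ hi => by simp [hi.symm]) (by simp),
      Finset.sum_eq_single (lv k) (fun l _ hl => by simp [hl.symm])
        (fun h => absurd (hlv k hk).1 h)]
    simp
  have hpref : ∀ i, ∀ k ∈ S.active, ∀ l,
      ∑ t ∈ Finset.Icc 1 l, (if q k = i ∧ lv k = t then (1 : ℝ) else 0) =
        if q k = i ∧ lv k ≤ l then 1 else 0 := by
    intro i k hk l
    have h1 := (Finset.mem_Icc.1 (hlv k hk).1).1
    simp only [ite_and]
    by_cases h : q k = i
    · simp [h, Finset.sum_ite_eq, h1]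
    · simp [h]
  -- The integral solution: each task completes on its own processor, in the interval of its
  -- completion time, capped at `L`.
  refine ⟨fun i k l => if q k = i ∧ lv k = l then 1 else 0, ?_, hcD, hD, ?_, ?_, ?_, ?_⟩
  · intro k hk
    have := hsum (fun _ => 1) k hk
    simp only [one_mul] at this
    exact this.ge
  · intro k hk
    rw [hsum (fun l => u * (1 + delta) ^ (l - 1)) k hk]
    exact (hlv k hk).2.1
  · intro i l hl
    have h1 : ∑ k ∈ S.active, S.p i k *
        ∑ t ∈ Finset.Icc 1 l, (if q k = i ∧ lv k = t then (1 : ℝ) else 0) =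
        ∑ k ∈ S.active with q k = i ∧ lv k ≤ l, S.p i k := by
      rw [Finset.sum_filter]
      refine Finset.sum_congr rfl fun k hk => ?_
      rw [hpref i k hk, mul_ite, mul_one, mul_zero]
    rw [h1]
    -- The last level may contain tasks completing beyond the horizon, so there the load is bounded
    -- by `tMax` instead of by the schedule.
    by_cases hlL : l = L
    · subst hlL
      exact (Finset.sum_le_sum_of_subset_of_nonneg (Finset.filter_subset _ _)
        (fun k hk _ => (mem_active.1 hk i).le)).trans
        ((S.sum_active_le_tMax i).trans (htL.trans (mul_pow_le_mul_pow hu.le (Nat.sub_le _ _))))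
    · refine hload i _ (mul_pow_nonneg hu.le l) _ (Finset.filter_subset _ _) fun k hk => ?_
      rw [Finset.mem_filter] at hk
      refine ⟨hk.2.1, ?_⟩
      have h2 := (Finset.mem_Icc.1 hl).2
      have h3 := (hlv k hk.1).2.2.resolve_right (by omega)
      exact h3.trans (mul_pow_le_mul_pow hu.le hk.2.2)
  · intro i k hk l hl hlong
    rw [if_neg]
    rintro ⟨rfl, rfl⟩
    rcases (hlv k hk).2.2 with h | h
    · linarith [hc k hk]
    · have h1 := htL.trans (mul_pow_le_mul_pow hu.le (Nat.sub_le L 1))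
      rw [h] at hlong
      linarith [p_le_tMax hk (q k)]
  · intro i k _ l _
    split_ifs <;> norm_num

variable {y : P → T → ℕ → ℝ} {C : T → ℝ} {D : J → ℝ}

/-- The completion times of a feasible solution can be cut off at the beginning of the last
interval, and the assignment variables at one. -/
theorem LPFeasible.exists_bounded (hu : 0 < u) (h : S.LPFeasible u y C D) :
    ∃ y' C', S.LPFeasible u y' C'
        (fun j => min (D j) (u * (1 + delta) ^ (S.numIntervals u - 1))) ∧
      (∀ i k l, 0 ≤ y' i k l ∧ y' i k l ≤ 1) ∧
      ∀ k, 0 ≤ C' k ∧ C' k ≤ u * (1 + delta) ^ (S.numIntervals u - 1) := by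
  classical
  set L := S.numIntervals u with hLdef
  set M := u * (1 + delta) ^ (L - 1) with hM
  have hM0 : 0 ≤ M := mul_pow_nonneg hu.le _
  set tot : T → ℝ := fun k => ∑ i, ∑ l ∈ Finset.Icc 1 L, y i k l with htot
  have htot1 : ∀ k ∈ S.active, 1 ≤ tot k := h.cover
  -- Normalizing to total exactly one only decreases the variables, so the load constraints survive.
  set y' : P → T → ℕ → ℝ := fun i k l =>
    if k ∈ S.active ∧ l ∈ Finset.Icc 1 L then y i k l / tot k else 0 with hy'
  have hy'eq : ∀ i, ∀ k ∈ S.active, ∀ l ∈ Finset.Icc 1 L, y' i k l = y i k l / tot k :=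
    fun i k hk l hl => if_pos ⟨hk, hl⟩
  have hy'0 : ∀ i k l, 0 ≤ y' i k l := by
    intro i k l
    simp only [hy']
    split_ifs with hkl
    · exact div_nonneg (h.nonneg i k hkl.1 l hkl.2) (zero_le_one.trans (htot1 k hkl.1))
    · exact le_rfl
  have hy'le : ∀ i, ∀ k ∈ S.active, ∀ l ∈ Finset.Icc 1 L, y' i k l ≤ y i k l := by
    intro i k hk l hl
    rw [hy'eq i k hk l hl]
    exact div_le_self (h.nonneg i k hk l hl) (htot1 k hk)
  have hcov : ∀ k ∈ S.active, ∑ i, ∑ l ∈ Finset.Icc 1 L, y' i k l = 1 := by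
    intro k hk
    have h1 : ∑ i, ∑ l ∈ Finset.Icc 1 L, y' i k l = tot k / tot k := by
      rw [htot, Finset.sum_div]
      refine Finset.sum_congr rfl fun i _ => ?_
      rw [Finset.sum_div]
      exact Finset.sum_congr rfl fun l hl => hy'eq i k hk l hl
    rw [h1, div_self (by linarith [htot1 k hk])]
  -- The smallest completion time the constraints allow: now a convex combination of left interval
  -- ends, hence at most `M`.
  set C' : T → ℝ := fun k => if k ∈ S.active then
    ∑ i, ∑ l ∈ Finset.Icc 1 L, u * (1 + delta) ^ (l - 1) * y' i k l else 0 with hC'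
  have hC'0 : ∀ k, 0 ≤ C' k := by
    intro k
    simp only [hC']
    split_ifs
    · exact Finset.sum_nonneg fun i _ => Finset.sum_nonneg fun l _ =>
        mul_nonneg (mul_pow_nonneg hu.le _) (hy'0 i k l)
    · exact le_rfl
  have hC'M : ∀ k, C' k ≤ M := by
    intro k
    simp only [hC']
    split_ifs with hk
    · calc ∑ i, ∑ l ∈ Finset.Icc 1 L, u * (1 + delta) ^ (l - 1) * y' i k l
          ≤ ∑ i, ∑ l ∈ Finset.Icc 1 L, M * y' i k l := by
            refine Finset.sum_le_sum fun i _ => Finset.sum_le_sum fun l hl => ?_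
            exact mul_le_mul_of_nonneg_right (mul_pow_le_mul_pow hu.le
              (Nat.sub_le_sub_right (Finset.mem_Icc.1 hl).2 1)) (hy'0 i k l)
        _ = M := by simp_rw [← Finset.mul_sum]; rw [hcov k hk, mul_one]
    · exact hM0
  have hC'C : ∀ k ∈ S.active, C' k ≤ C k := by
    intro k hk
    refine le_trans ?_ (h.lower k hk)
    simp only [hC', if_pos hk]
    exact Finset.sum_le_sum fun i _ => Finset.sum_le_sum fun l hl =>
      mul_le_mul_of_nonneg_left (hy'le i k hk l hl) (mul_pow_nonneg hu.le _)
  refine ⟨y', C', ⟨fun k hk => (hcov k hk).ge, ?_, fun j => le_min (h.dummy_nonneg j) hM0, ?_, ?_,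
    ?_, fun i k _ l _ => hy'0 i k l⟩, fun i k l => ⟨hy'0 i k l, ?_⟩, fun k => ⟨hC'0 k, hC'M k⟩⟩
  · exact fun k hk => le_min ((hC'C k hk).trans (h.dummy k hk)) (hC'M k)
  · intro k hk
    simp only [hC', if_pos hk]
    exact le_rfl
  · intro i l hl
    refine le_trans (Finset.sum_le_sum fun k hk => ?_) (h.load i l hl)
    refine mul_le_mul_of_nonneg_left (Finset.sum_le_sum fun t ht => hy'le i k hk t ?_)
      (mem_active.1 hk i).le
    rw [Finset.mem_Icc] at *
    exact ⟨ht.1, ht.2.trans hl.2⟩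
  · intro i k hk l hl hlong
    rw [hy'eq i k hk l hl, h.too_long i k hk l hl hlong, zero_div]
  · by_cases hkl : k ∈ S.active ∧ l ∈ Finset.Icc 1 L
    · rw [← hcov k hkl.1]
      refine le_trans ?_ (Finset.single_le_sum (f := fun i => ∑ l ∈ Finset.Icc 1 L, y' i k l)
        (fun i _ => Finset.sum_nonneg fun l _ => hy'0 i k l) (Finset.mem_univ i))
      exact Finset.single_le_sum (f := fun l => y' i k l) (fun l _ => hy'0 i k l) hkl.2
    · simp only [hy', if_neg hkl]
      exact zero_le_one

/-- All constraints are equations or non-strict inequalities in the variables; the strict premise of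
`too_long` does not involve them. -/
theorem isClosed_LPFeasible (S : Stage J T P) (u : ℝ) :
    IsClosed {z : (P → T → ℕ → ℝ) × (T → ℝ) × (J → ℝ) | S.LPFeasible u z.1 z.2.1 z.2.2} := by
  have h : {z : (P → T → ℕ → ℝ) × (T → ℝ) × (J → ℝ) | S.LPFeasible u z.1 z.2.1 z.2.2} =
      {z | (∀ k ∈ S.active, 1 ≤ ∑ i, ∑ l ∈ Finset.Icc 1 (S.numIntervals u), z.1 i k l) ∧
        (∀ k ∈ S.active, z.2.1 k ≤ z.2.2 (S.job k)) ∧ (∀ j, 0 ≤ z.2.2 j) ∧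
        (∀ k ∈ S.active, ∑ i, ∑ l ∈ Finset.Icc 1 (S.numIntervals u),
          u * (1 + delta) ^ (l - 1) * z.1 i k l ≤ z.2.1 k) ∧
        (∀ i, ∀ l ∈ Finset.Icc 1 (S.numIntervals u),
          ∑ k ∈ S.active, S.p i k * ∑ t ∈ Finset.Icc 1 l, z.1 i k t ≤ u * (1 + delta) ^ l) ∧
        (∀ i, ∀ k ∈ S.active, ∀ l ∈ Finset.Icc 1 (S.numIntervals u),
          u * (1 + delta) ^ l < S.p i k → z.1 i k l = 0) ∧
        ∀ i, ∀ k ∈ S.active, ∀ l ∈ Finset.Icc 1 (S.numIntervals u), 0 ≤ z.1 i k l} := by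
    ext z
    exact ⟨fun h => ⟨h.1, h.2, h.3, h.4, h.5, h.6, h.7⟩,
      fun ⟨h1, h2, h3, h4, h5, h6, h7⟩ => ⟨h1, h2, h3, h4, h5, h6, h7⟩⟩
  rw [h]
  simp only [Set.ofPred_and, Set.ofPred_forall]
  refine .inter ?_ (.inter ?_ (.inter ?_ (.inter ?_ (.inter ?_ (.inter ?_ ?_)))))
  · exact isClosed_iInter fun k => isClosed_iInter fun _ => isClosed_le (by fun_prop) (by fun_prop)
  · exact isClosed_iInter fun k => isClosed_iInter fun _ => isClosed_le (by fun_prop) (by fun_prop)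
  · exact isClosed_iInter fun k => isClosed_le (by fun_prop) (by fun_prop)
  · exact isClosed_iInter fun k => isClosed_iInter fun _ => isClosed_le (by fun_prop) (by fun_prop)
  · exact isClosed_iInter fun k => isClosed_iInter fun l => isClosed_iInter fun _ =>
      isClosed_le (by fun_prop) (by fun_prop)
  · exact isClosed_iInter fun i => isClosed_iInter fun k => isClosed_iInter fun _ =>
      isClosed_iInter fun l => isClosed_iInter fun _ => isClosed_iInter fun _ =>
      isClosed_eq (by fun_prop) (by fun_prop)
  · exact isClosed_iInter fun i => isClosed_iInter fun k => isClosed_iInter fun _ =>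
      isClosed_iInter fun l => isClosed_iInter fun _ => isClosed_le (by fun_prop) (by fun_prop)

/-- The feasible region is unbounded, but every feasible point is dominated by one in the box `[0,
b]`, where compactness yields a minimizer. -/
theorem exists_LPOptimal [Fintype J] (hu : 0 < u) (hw : ∀ j, 0 ≤ S.w j)
    (h : S.LPFeasible u y C D) : ∃ y C D, S.LPOptimal u y C D := by
  set M := u * (1 + delta) ^ (S.numIntervals u - 1) with hM
  have hM0 : 0 ≤ M := mul_pow_nonneg hu.le _
  let b : (P → T → ℕ → ℝ) × (T → ℝ) × (J → ℝ) := (fun _ _ _ => 1, fun _ => M, fun _ => M)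
  have hK : IsCompact ({z : (P → T → ℕ → ℝ) × (T → ℝ) × (J → ℝ) |
      S.LPFeasible u z.1 z.2.1 z.2.2} ∩ Set.Icc 0 b) :=
    isCompact_Icc.inter_left (S.isClosed_LPFeasible u)
  have hbd : ∀ y C D, S.LPFeasible u y C D → ∃ z ∈ ({z : (P → T → ℕ → ℝ) × (T → ℝ) × (J → ℝ) |
      S.LPFeasible u z.1 z.2.1 z.2.2} ∩ Set.Icc 0 b), z.2.2 ≤ D := by
    intro y C D h
    obtain ⟨y', C', h1, h2, h3⟩ := h.exists_bounded hu
    refine ⟨(y', C', _), ⟨h1, ⟨fun i k l => (h2 i k l).1, fun k => (h3 k).1, h1.dummy_nonneg⟩,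
      ⟨fun i k l => (h2 i k l).2, fun k => (h3 k).2, fun j => min_le_right _ _⟩⟩,
      fun j => min_le_left _ _⟩
  obtain ⟨z₀, hz₀, -⟩ := hbd y C D h
  obtain ⟨z, hz, hmin⟩ := hK.exists_isMinOn ⟨z₀, hz₀⟩
    (f := fun z => ∑ j, S.w j * z.2.2 j) (by fun_prop)
  refine ⟨z.1, z.2.1, z.2.2, hz.1, fun y' C' D' h' => ?_⟩
  obtain ⟨z', hz', hle⟩ := hbd y' C' D' h'
  exact (hmin hz').trans (Finset.sum_le_sum fun j _ => mul_le_mul_of_nonneg_left (hle j) (hw j))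

/-- Weights are positive, so cutting off a larger `D j` would strictly lower the objective. This is
what guarantees that the last class can take every remaining task. -/
theorem LPOptimal.dummy_le [Fintype J] (hu : 0 < u) (hw : ∀ j, 0 < S.w j)
    (h : S.LPOptimal u y C D) (j : J) :
    D j ≤ u * (1 + delta) ^ (S.numIntervals u - 1) := by
  obtain ⟨y', C', h1, -⟩ := h.1.exists_bounded hu
  by_contra hj
  refine absurd (h.2 _ _ _ h1) (not_le.2 (Finset.sum_lt_sum (fun j _ => ?_)
    ⟨j, Finset.mem_univ j, ?_⟩))
  · exact mul_le_mul_of_nonneg_left (min_le_left _ _) (hw j).le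
  · exact mul_lt_mul_of_pos_left (min_lt_of_right_lt (not_le.1 hj)) (hw j)

theorem LPFeasible.unit_le (hu : 0 < u) (h : S.LPFeasible u y C D) {k : T} (hk : k ∈ S.active) :
    u ≤ C k := by
  refine le_trans ?_ (h.lower k hk)
  calc u ≤ u * ∑ i, ∑ l ∈ Finset.Icc 1 (S.numIntervals u), y i k l :=
        le_mul_of_one_le_right hu.le (h.cover k hk)
    _ = ∑ i, ∑ l ∈ Finset.Icc 1 (S.numIntervals u), u * y i k l := by
        simp_rw [Finset.mul_sum]
    _ ≤ _ := by
        refine Finset.sum_le_sum fun i _ => Finset.sum_le_sum fun l hl =>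
          mul_le_mul_of_nonneg_right ?_ (h.nonneg i k hk l hl)
        simpa using mul_pow_le_mul_pow hu.le (Nat.zero_le (l - 1))

theorem LPFeasible.yStar_nonneg (h : S.LPFeasible u y C D) {cls : T → ℕ} {k : T}
    (hk : k ∈ S.active) (hcls : cls k ∈ Finset.Icc 1 (S.numIntervals u)) (i : P) :
    0 ≤ yStar y cls i k := by
  refine mul_nonneg (by unfold alpha; norm_num) (Finset.sum_nonneg fun t ht =>
    h.nonneg i k hk t ?_)
  rw [Finset.mem_Icc] at *
  exact ⟨ht.1, ht.2.trans hcls.2⟩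

/-- Markov's inequality: the part of `k` in intervals after its class pays at least `alpha * C k`
per unit, so it has mass at most `1 / alpha = 2/3`. At least `1/3` remains, and `alpha / (alpha - 1)
= 3`. -/
theorem LPFeasible.one_le_sum_yStar (hu : 0 < u) (h : S.LPFeasible u y C D) {cls : T → ℕ} {k : T}
    (hk : k ∈ S.active) (hcls : cls k ∈ Finset.Icc 1 (S.numIntervals u))
    (hupper : alpha * C k ≤ u * (1 + delta) ^ cls k) : 1 ≤ ∑ i, yStar y cls i k := by
  set L := S.numIntervals u with hL
  have hC : 0 < C k := hu.trans_le (h.unit_le hu hk)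
  have hsplit : ∀ i, ∑ l ∈ Finset.Icc 1 (cls k), y i k l =
      ∑ l ∈ Finset.Icc 1 L, if l ≤ cls k then y i k l else 0 := by
    intro i
    rw [← Finset.sum_filter]
    congr 1
    ext l
    simp only [Finset.mem_filter, Finset.mem_Icc] at *
    omega
  have h1 : alpha * C k * (∑ i, ∑ l ∈ Finset.Icc 1 L, y i k l -
      ∑ i, ∑ l ∈ Finset.Icc 1 (cls k), y i k l) ≤ C k := by
    refine le_trans ?_ (h.lower k hk)
    simp_rw [hsplit]
    rw [← Finset.sum_sub_distrib, Finset.mul_sum]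
    refine Finset.sum_le_sum fun i _ => ?_
    rw [← Finset.sum_sub_distrib, Finset.mul_sum]
    refine Finset.sum_le_sum fun l hl => ?_
    have h2 := h.nonneg i k hk l hl
    split_ifs with h3
    · rw [sub_self, mul_zero]
      exact mul_nonneg (mul_pow_nonneg hu.le _) h2
    · rw [sub_zero]
      exact mul_le_mul_of_nonneg_right (hupper.trans (mul_pow_le_mul_pow hu.le (by omega))) h2
  have h2 := h.cover k hk
  unfold yStar
  rw [← Finset.mul_sum]
  set m := ∑ i, ∑ l ∈ Finset.Icc 1 L, y i k l
  set m' := ∑ i, ∑ l ∈ Finset.Icc 1 (cls k), y i k l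
  unfold alpha at *
  have h3 : 3 / 2 * (m - m') ≤ 1 := by
    by_contra h4
    push Not at h4
    nlinarith
  linarith

/-! ### Runs of TaskScheduling -/

theorem exists_taskSchedulingRun [Fintype J] (S : Stage J T P) (hu : 0 < u)
    (hw : ∀ j, 0 < S.w j) (hp : ∀ i k, 0 ≤ S.p i k)
    (hunit : ∀ i k, S.p i k ≠ 0 → u ≤ S.p i k) : Nonempty (S.TaskSchedulingRun u) := by
  classical
  -- A feasible point: all tasks on one processor, all declared complete at `tMax`.
  obtain ⟨y₀, hy₀⟩ := S.exists_LPFeasible hu (fun k hk i => hunit i k (mem_active.1 hk i).ne')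
    (fun _ => Classical.arbitrary P) (fun _ => S.tMax) (fun _ => S.tMax) (fun _ => S.tMax_nonneg)
    (fun _ _ => le_rfl) (fun k hk => p_le_tMax hk _) (by
      intro i W hW B hB h
      rcases B.eq_empty_or_nonempty with rfl | ⟨k, hk⟩
      · simpa using hW
      · exact (Finset.sum_le_sum_of_subset_of_nonneg hB
          (fun k hk _ => (mem_active.1 hk i).le)).trans
          ((S.sum_active_le_tMax i).trans (h k hk).2))
  obtain ⟨y, C, D, hopt⟩ := exists_LPOptimal hu (fun j => (hw j).le) hy₀
  obtain ⟨hL, -⟩ := S.numIntervals_spec hu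
  set L := S.numIntervals u with hLdef
  have hlev : ∀ k, ∃ l, (k ∉ S.active → l = 0) ∧ (k ∈ S.active → l ∈ Finset.Icc 1 L ∧
      u * (1 + delta) ^ (l - 1) ≤ alpha * C k ∧ alpha * C k ≤ u * (1 + delta) ^ l) := by
    intro k
    by_cases hk : k ∈ S.active
    · have h1 : u ≤ alpha * C k := by
        have h1 := hopt.1.unit_le hu hk
        unfold alpha
        linarith
      obtain ⟨l, h2, h3, h4⟩ := exists_level h1 hL
      refine ⟨l, fun h => absurd hk h, fun _ => ⟨h2, h3, ?_⟩⟩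
      rcases h4 with h4 | h4
      · exact h4
      · have h5 := (hopt.1.dummy k hk).trans (hopt.dummy_le hu hw _)
        rw [h4]
        obtain ⟨n, hn⟩ := Nat.exists_eq_add_of_le' hL
        rw [← hLdef, hn, Nat.add_sub_cancel] at h5
        rw [hn, pow_succ, one_add_delta] at *
        unfold alpha
        linarith
    · exact ⟨0, fun _ => rfl, fun h => absurd h hk⟩
  choose cls hcls0 hcls using hlev
  have hord : ∀ i, ∃ o : T → ℕ, Function.Injective o ∧ ∀ k k', o k < o k' → S.p i k' ≤ S.p i k := by
    intro i
    obtain ⟨o, h1, h2⟩ := exists_injective_strictMono (fun k => - S.p i k)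
    refine ⟨o, h1, fun k k' h => ?_⟩
    by_contra h3
    exact absurd (h2 k' k (neg_lt_neg (not_le.1 h3))) (not_lt.2 h.le)
  choose ord hord_inj hord_sort using hord
  obtain ⟨rank, hrank_inj, hrank⟩ := exists_injective_strictMono cls
  obtain ⟨proc, slot, h1, h2⟩ := exists_slot_matching S.active cls ord hord_inj (yStar y cls)
    (fun i k hk => hopt.1.yStar_nonneg hk (hcls k hk).1 i)
    (fun k hk => hopt.1.one_le_sum_yStar hu hk (hcls k hk).1 (hcls k hk).2.2)
  have hzero : ∀ k, ∃ i, k ∉ S.active → S.p i k = 0 := by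
    intro k
    by_cases hk : k ∈ S.active
    · exact ⟨Classical.arbitrary P, fun h => absurd hk h⟩
    · have h3 := hk
      rw [mem_active] at h3
      push Not at h3
      obtain ⟨i, hi⟩ := h3
      exact ⟨i, fun _ => le_antisymm hi (hp i k)⟩
  choose z hz using hzero
  have hproc : ∀ k ∈ S.active, (if k ∈ S.active then proc k else z k) = proc k :=
    fun k hk => if_pos hk
  have hamount : ∀ i k, S.amountBefore y cls ord i k =
      ∑ k' ∈ S.active with cls k' = cls k ∧ ord i k' < ord i k, yStar y cls i k' := by
    intro i k
    unfold amountBefore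
    congr!
  exact ⟨{
    y := y, C := C, D := D, optimal := hopt, cls := cls, cls_inactive := hcls0
    cls_mem := fun k hk => (hcls k hk).1
    cls_lower := fun k hk => (hcls k hk).2.1
    cls_upper := fun k hk => (hcls k hk).2.2
    ord := ord, ord_injective := hord_inj, ord_sorted := hord_sort
    proc := fun k => if k ∈ S.active then proc k else z k
    slot := slot
    proc_inactive := fun k hk => by
      rw [if_neg hk]
      exact hz k hk
    yStar_pos := fun k hk => by
      rw [hproc k hk]
      exact (h1 k hk).1
    slot_upper := fun k hk => by
      rw [hproc k hk, hamount]
      exact (h1 k hk).2.1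
    slot_lower := fun k hk => by
      rw [hproc k hk, hamount]
      exact (h1 k hk).2.2
    slot_matching := fun k hk k' hk' hc hpr hs => by
      rw [hproc k hk, hproc k' hk'] at hpr
      exact h2 k hk k' hk' hc hpr hs
    rank := rank, rank_injective := hrank_inj, rank_sorted := hrank }⟩

namespace TaskSchedulingRun

variable [Fintype J] (run : S.TaskSchedulingRun u)

open Classical in
/-- The load that one class puts on a processor. -/
theorem class_load_le (hu : 0 < u) (i : P) {l : ℕ} (hl : l ∈ Finset.Icc 1 (S.numIntervals u)) :
    ∑ k ∈ S.active with run.proc k = i ∧ run.cls k = l, S.p i k ≤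
      u * (1 + delta) ^ l +
        3 * ∑ k ∈ S.active with run.cls k = l, S.p i k * ∑ t ∈ Finset.Icc 1 l, run.y i k t := by
  -- A task is matched only to a processor with positive `yStar`; if it were too long there, all
  -- variables up to level `l` would vanish.
  have hle : ∀ k ∈ S.active.filter (fun k => run.proc k = i ∧ run.cls k = l),
      S.p i k ≤ u * (1 + delta) ^ l := by
    intro k hk
    obtain ⟨hkS, rfl, rfl⟩ := Finset.mem_filter.1 hk
    by_contra hlong
    push Not at hlong
    refine (run.yStar_pos k hkS).ne' ?_
    unfold yStar
    rw [Finset.sum_eq_zero, mul_zero]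
    intro t ht
    rw [Finset.mem_Icc] at *
    exact run.optimal.1.too_long _ k hkS t (Finset.mem_Icc.2 ⟨ht.1, ht.2.trans hl.2⟩)
      ((mul_pow_le_mul_pow hu.le ht.2).trans_lt hlong)
  have h := sum_le_of_slots (S.active.filter (fun k => run.cls k = l))
    (S.active.filter (fun k => run.proc k = i ∧ run.cls k = l))
    (fun k hk => by
      rw [Finset.mem_filter] at *
      exact ⟨hk.1, hk.2.2⟩)
    (run.ord_injective i) (yStar run.y run.cls i) (S.p i)
    (fun k hk => run.optimal.1.yStar_nonneg (Finset.mem_filter.1 hk).1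
      (run.cls_mem k (Finset.mem_filter.1 hk).1) i)
    (fun k hk => (mem_active.1 (Finset.mem_filter.1 hk).1 i).le)
    (run.ord_sorted i) run.slot
    (by
      intro k hk k' hk' hs
      obtain ⟨h1, h2, h3⟩ := Finset.mem_filter.1 (Finset.mem_coe.1 hk)
      obtain ⟨h1', h2', h3'⟩ := Finset.mem_filter.1 (Finset.mem_coe.1 hk')
      exact run.slot_matching k h1 k' h1' (h3.trans h3'.symm) (h2.trans h2'.symm) hs)
    (by
      intro k hk
      obtain ⟨h1, rfl, rfl⟩ := Finset.mem_filter.1 hk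
      rw [Finset.filter_filter]
      exact run.slot_lower k h1)
    (mul_pow_nonneg hu.le l) hle
  refine h.trans (le_of_eq ?_)
  rw [Finset.mul_sum]
  congr 1
  refine Finset.sum_congr rfl fun k hk => ?_
  rw [Finset.mem_filter] at hk
  unfold yStar alpha
  rw [hk.2]
  ring

/-- Class `0` precedes all classes of active tasks, so only tasks taking no time run up to such a
task. -/
theorem finish_of_notMem_active {k : T} (hk : k ∉ S.active) : run.finish k = 0 := by
  classical
  refine Finset.sum_eq_zero fun k' hk' => ?_
  obtain ⟨-, h1, h2⟩ := Finset.mem_filter.1 hk'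
  have h3 : k' ∉ S.active := fun h => by
    have h4 := (Finset.mem_Icc.1 (run.cls_mem k' h)).1
    have h5 := run.rank_sorted k k' (by rw [run.cls_inactive k hk]; omega)
    omega
  rw [← h1]
  exact run.proc_inactive k' h3

/-- Only tasks of classes up to that of `k` run before it; summing `class_load_le` over these
classes gives the bound. -/
theorem finish_le_of_mem_active (hu : 0 < u) {k : T} (hk : k ∈ S.active) :
    run.finish k ≤ 27 / 2 * run.C k := by
  classical
  set i := run.proc k with hi
  set n := run.cls k with hn
  have hnL := run.cls_mem k hk
  rw [← hn] at hnL
  obtain ⟨hn1, hn2⟩ := Finset.mem_Icc.1 hnL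
  have hy : ∀ k' ∈ S.active, ∀ t ∈ Finset.Icc 1 n, 0 ≤ run.y i k' t := fun k' hk' t ht =>
    run.optimal.1.nonneg i k' hk' t (Finset.mem_Icc.2
      ⟨(Finset.mem_Icc.1 ht).1, (Finset.mem_Icc.1 ht).2.trans hn2⟩)
  have h1 : run.finish k ≤ ∑ k' ∈ S.active with run.proc k' = i ∧ run.cls k' ≤ n, S.p i k' := by
    unfold finish
    rw [← hi]
    have h2 : ∑ k' ∈ S.active with run.proc k' = i ∧ run.rank k' ≤ run.rank k, S.p i k' =
        ∑ k' with run.proc k' = i ∧ run.rank k' ≤ run.rank k, S.p i k' := by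
      refine Finset.sum_subset (Finset.filter_subset_filter _ (Finset.subset_univ _)) ?_
      intro k' hk' hk''
      obtain ⟨-, h3, h4⟩ := Finset.mem_filter.1 hk'
      rw [← h3]
      exact run.proc_inactive k' fun h => hk'' (Finset.mem_filter.2 ⟨h, h3, h4⟩)
    have h3 : S.active.filter (fun k' => run.proc k' = i ∧ run.rank k' ≤ run.rank k) ⊆
        S.active.filter (fun k' => run.proc k' = i ∧ run.cls k' ≤ n) := by
      intro k' hk'
      obtain ⟨h4, h5, h6⟩ := Finset.mem_filter.1 hk'
      refine Finset.mem_filter.2 ⟨h4, h5, ?_⟩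
      by_contra h7
      exact absurd (run.rank_sorted k k' (not_le.1 h7)) (not_lt.2 h6)
    have h4 := Finset.sum_le_sum_of_subset_of_nonneg (f := fun k' => S.p i k') h3
      (fun k' hk' _ => (mem_active.1 (Finset.mem_filter.1 hk').1 i).le)
    rw [h2] at h4
    convert h4
  have h2 : ∑ k' ∈ S.active with run.proc k' = i ∧ run.cls k' ≤ n, S.p i k' =
      ∑ l ∈ Finset.Icc 1 n,
        ∑ k' ∈ S.active with run.proc k' = i ∧ run.cls k' = l, S.p i k' := by
    rw [← Finset.sum_fiberwise_of_maps_to (g := run.cls) (t := Finset.Icc 1 n)]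
    · refine Finset.sum_congr rfl fun l hl => ?_
      rw [Finset.filter_filter]
      congr 1
      ext k'
      simp only [Finset.mem_filter, Finset.mem_Icc] at *
      constructor
      · rintro ⟨h3, ⟨h4, -⟩, h5⟩
        exact ⟨h3, h4, h5⟩
      · rintro ⟨h3, h4, h5⟩
        exact ⟨h3, ⟨h4, by omega⟩, h5⟩
    · intro k' hk'
      obtain ⟨h3, -, h4⟩ := Finset.mem_filter.1 hk'
      exact Finset.mem_Icc.2 ⟨(Finset.mem_Icc.1 (run.cls_mem k' h3)).1, h4⟩
  -- Each task belongs to one class; extending its prefix from its own class to `n` brings all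
  -- classes under the single load constraint at level `n`.
  have h3 : ∑ l ∈ Finset.Icc 1 n, ∑ k' ∈ S.active with run.cls k' = l,
      S.p i k' * ∑ t ∈ Finset.Icc 1 l, run.y i k' t ≤ u * (1 + delta) ^ n := by
    refine le_trans ?_ (run.optimal.1.load i n hnL)
    have h4 : ∀ k' ∈ S.active, 0 ≤ S.p i k' * ∑ t ∈ Finset.Icc 1 n, run.y i k' t :=
      fun k' hk' => mul_nonneg (mem_active.1 hk' i).le (Finset.sum_nonneg (hy k' hk'))
    calc _ ≤ ∑ l ∈ Finset.Icc 1 n, ∑ k' ∈ S.active with run.cls k' = l,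
          S.p i k' * ∑ t ∈ Finset.Icc 1 n, run.y i k' t := by
          refine Finset.sum_le_sum fun l hl => Finset.sum_le_sum fun k' hk' => ?_
          have hk'' := (Finset.mem_filter.1 hk').1
          refine mul_le_mul_of_nonneg_left ?_ (mem_active.1 hk'' i).le
          exact Finset.sum_le_sum_of_subset_of_nonneg
            (Finset.Icc_subset_Icc le_rfl (Finset.mem_Icc.1 hl).2) (fun t ht _ => hy k' hk'' t ht)
      _ = ∑ k' ∈ S.active with run.cls k' ∈ Finset.Icc 1 n,
          S.p i k' * ∑ t ∈ Finset.Icc 1 n, run.y i k' t := by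
          rw [← Finset.sum_fiberwise_of_maps_to (g := run.cls) (t := Finset.Icc 1 n)
            (fun k' hk' => (Finset.mem_filter.1 hk').2)]
          refine Finset.sum_congr rfl fun l hl => ?_
          rw [Finset.filter_filter]
          congr 1
          ext k'
          simp only [Finset.mem_filter]
          constructor
          · rintro ⟨h5, rfl⟩
            exact ⟨h5, hl, rfl⟩
          · rintro ⟨h5, -, h6⟩
            exact ⟨h5, h6⟩
      _ ≤ _ := Finset.sum_le_sum_of_subset_of_nonneg (Finset.filter_subset _ _)
          (fun k' hk' _ => h4 k' hk')
  -- Three from the geometric sum of the longest tasks, three from the scaled LP load.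
  have h4 : run.finish k ≤ 6 * (u * (1 + delta) ^ n) := by
    refine h1.trans ?_
    rw [h2]
    refine (Finset.sum_le_sum fun l hl => run.class_load_le hu i (Finset.mem_Icc.2
      ⟨(Finset.mem_Icc.1 hl).1, (Finset.mem_Icc.1 hl).2.trans hn2⟩)).trans ?_
    have h5 := sum_pow_le hu.le n
    rw [Finset.sum_add_distrib]
    simp_rw [← Finset.mul_sum] at h3 h5 ⊢
    linarith
  have h5 := run.cls_lower k hk
  rw [← hn] at h5
  obtain ⟨m, hm⟩ := Nat.exists_eq_add_of_le' hn1
  rw [hm, Nat.add_sub_cancel] at h5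
  rw [hm, pow_succ] at h4
  rw [one_add_delta] at *
  unfold alpha at h5
  linarith

theorem finish_le (hu : 0 < u) (k : T) : run.finish k ≤ 27 / 2 * run.D (S.job k) := by
  by_cases hk : k ∈ S.active
  · linarith [run.finish_le_of_mem_active hu hk, run.optimal.1.dummy k hk]
  · rw [run.finish_of_notMem_active hk]
    linarith [run.optimal.1.dummy_nonneg (S.job k)]

theorem finish_nonneg (hp : ∀ i k, 0 ≤ S.p i k) (k : T) : 0 ≤ run.finish k :=
  Finset.sum_nonneg fun _ _ => hp _ _

/-- The tasks of a processor that are finished by the time `W` have total length at most `W`. -/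
theorem sum_le_of_finish_le (hp : ∀ i k, 0 ≤ S.p i k) (i : P) {W : ℝ} (hW : 0 ≤ W) (B : Finset T)
    (hB : ∀ k ∈ B, run.proc k = i ∧ run.finish k ≤ W) : ∑ k ∈ B, S.p i k ≤ W := by
  classical
  rcases B.eq_empty_or_nonempty with rfl | hne
  · simpa using hW
  · obtain ⟨k, hk, hmax⟩ := B.exists_max_image run.rank hne
    refine le_trans ?_ (hB k hk).2
    unfold finish
    rw [(hB k hk).1]
    exact Finset.sum_le_sum_of_subset_of_nonneg
      (fun k' hk' => Finset.mem_filter.2 ⟨Finset.mem_univ _, (hB k' hk').1, hmax k' hk'⟩)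
      (fun k' _ _ => hp i k')

end TaskSchedulingRun

end Stage

end MapReduce

namespace MapReduce

/-! ### Merging the two stages: width bounds -/

namespace MRInstance

variable {J PM PR : Type*} {I : MRInstance J PM PR}

theorem map_le_width (fM : I.MapTask → ℝ) (fR : I.ReduceTask → ℝ) (k : I.MapTask) :
    fM k ≤ I.width fM fR k.1 :=
  le_max_of_le_left (Finset.le_sup' (fun k' => fM ⟨k.1, k'⟩) (Finset.mem_univ k.2))

theorem reduce_le_width (fM : I.MapTask → ℝ) (fR : I.ReduceTask → ℝ) (r : I.ReduceTask) :
    fR r ≤ I.width fM fR r.1 :=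
  le_max_of_le_right (Finset.le_sup' (fun r' => fR ⟨r.1, r'⟩) (Finset.mem_univ r.2))

variable [Fintype J] [Fintype PM] [Fintype PR] [Nonempty PM] [Nonempty PR] {u : ℝ}

theorem exists_MRSRun (hM : Nonempty (I.mapStage.TaskSchedulingRun u))
    (hR : Nonempty (I.reduceStage.TaskSchedulingRun u)) : Nonempty (I.MRSRun u) := by
  classical
  obtain ⟨mapRun⟩ := hM
  obtain ⟨reduceRun⟩ := hR
  choose sM hsM using fun i => Dispatch.exists_start (fun k => I.mapStage.p i k) (fun _ => 0)
    (fun k => I.width mapRun.finish reduceRun.finish k.1) 0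
    (Finset.univ.filter fun k => mapRun.proc k = i)
  choose sR hsR using fun i => Dispatch.exists_start (fun r => I.reduceStage.p i r)
    (fun r => I.width mapRun.finish reduceRun.finish r.1)
    (fun r => I.width mapRun.finish reduceRun.finish r.1) 0
    (Finset.univ.filter fun r => reduceRun.proc r = i)
  -- The start times of the separate processors are glued: each task takes the one given by its own
  -- processor.
  refine ⟨⟨mapRun, reduceRun, fun k => sM (mapRun.proc k) k, fun r => sR (reduceRun.proc r) r,
    fun i => ?_, fun i => ?_⟩⟩
  · have h := hsM i
    rw [Finset.coe_filter_univ] at h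
    refine h.congr fun k hk => ?_
    rw [show mapRun.proc k = i from hk]
  · have h := hsR i
    rw [Finset.coe_filter_univ] at h
    refine h.congr fun r hr => ?_
    rw [show reduceRun.proc r = i from hr]

namespace MRSRun

variable (run : I.MRSRun u)

/-- The width of a job in a run of MRS. -/
noncomputable def jobWidth (j : J) : ℝ := I.width run.mapRun.finish run.reduceRun.finish j

theorem jobWidth_nonneg (j : J) : 0 ≤ run.jobWidth j :=
  (run.mapRun.finish_nonneg (fun i k => I.pMap_nonneg i k.1 k.2)
    ⟨j, ⟨0, I.numMap_pos j⟩⟩).trans (map_le_width _ _ (⟨j, ⟨0, I.numMap_pos j⟩⟩ : I.MapTask))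

/-- The maximum over the stages is bounded by a sum, so that each stage can be compared with its own
linear program. -/
theorem jobWidth_le (hu : 0 < u) (j : J) :
    run.jobWidth j ≤ 27 / 2 * (run.mapRun.D j + run.reduceRun.D j) := by
  have h1 := run.mapRun.optimal.1.dummy_nonneg j
  have h2 := run.reduceRun.optimal.1.dummy_nonneg j
  refine max_le (Finset.sup'_le _ _ fun k _ => ?_) (Finset.sup'_le _ _ fun r _ => ?_)
  · have h3 : run.mapRun.finish ⟨j, k⟩ ≤ 27 / 2 * run.mapRun.D j := run.mapRun.finish_le hu ⟨j, k⟩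
    linarith
  · have h3 : run.reduceRun.finish ⟨j, r⟩ ≤ 27 / 2 * run.reduceRun.D j :=
      run.reduceRun.finish_le hu ⟨j, r⟩
    linarith

theorem mapStart_nonneg (k : I.MapTask) : 0 ≤ run.mapStart k :=
  ((run.map_dispatch (run.mapRun.proc k)).le_start (fun k => I.pMap_nonneg _ k.1 k.2) k rfl).1

theorem jobWidth_le_reduceStart (r : I.ReduceTask) : run.jobWidth r.1 ≤ run.reduceStart r :=
  ((run.reduce_dispatch (run.reduceRun.proc r)).le_start
    (fun r => I.pReduce_nonneg _ r.1 r.2) r rfl).2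

/-- All Map tasks are released at time zero, so a task waits only for tasks of no larger width. In
the separate schedule these finish on the same processor within that width, so they fit into it. -/
theorem map_finish_le (k : I.MapTask) :
    run.mapStart k + I.pMap (run.mapRun.proc k) k.1 k.2 ≤ run.jobWidth k.1 := by
  classical
  have hp : ∀ i k, 0 ≤ I.mapStage.p i k := fun i k => I.pMap_nonneg i k.1 k.2
  have h1 := (run.map_dispatch (run.mapRun.proc k)).finish_le (hp _) (fun _ _ _ => le_rfl) k rfl
  rw [max_self, zero_add] at h1
  refine h1.trans (run.mapRun.sum_le_of_finish_le hp _ (run.jobWidth_nonneg k.1) _ fun k' hk' => ?_)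
  obtain ⟨-, h2, h3⟩ := Finset.mem_filter.1 hk'
  exact ⟨h2, (map_le_width _ _ k').trans h3⟩

/-- One width until the release, and at most one more for all tasks of no larger width. Since
release time equals width, a task already running at the release has no larger width either. -/
theorem reduce_finish_le (r : I.ReduceTask) :
    run.reduceStart r + I.pReduce (run.reduceRun.proc r) r.1 r.2 ≤ 2 * run.jobWidth r.1 := by
  classical
  have hp : ∀ i r, 0 ≤ I.reduceStage.p i r := fun i r => I.pReduce_nonneg i r.1 r.2
  have h1 := (run.reduce_dispatch (run.reduceRun.proc r)).finish_le (hp _) (fun _ _ h => h) r rfl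
  have h0 := run.jobWidth_nonneg r.1
  rw [two_mul]
  refine h1.trans (add_le_add (max_le h0 le_rfl)
    (run.reduceRun.sum_le_of_finish_le hp _ h0 _ fun r' hr' => ?_))
  obtain ⟨-, h2, h3⟩ := Finset.mem_filter.1 hr'
  exact ⟨h2, (reduce_le_width _ _ r').trans h3⟩

theorem map_nonOverlapping : NonOverlapping run.mapRun.proc run.mapStart
    (fun k => run.mapStart k + I.pMap (run.mapRun.proc k) k.1 k.2) := by
  intro a b hab hproc
  have h := (run.map_dispatch (run.mapRun.proc a)).nonOverlapping
    (fun k => I.pMap_nonneg _ k.1 k.2) a rfl b hproc.symm hab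
  dsimp only
  rw [← hproc]
  exact h

theorem reduce_nonOverlapping : NonOverlapping run.reduceRun.proc run.reduceStart
    (fun r => run.reduceStart r + I.pReduce (run.reduceRun.proc r) r.1 r.2) := by
  intro a b hab hproc
  have h := (run.reduce_dispatch (run.reduceRun.proc a)).nonOverlapping
    (fun r => I.pReduce_nonneg _ r.1 r.2) a rfl b hproc.symm hab
  dsimp only
  rw [← hproc]
  exact h

end MRSRun

end MRInstance

/-! ### Shuffle tasks inside the reserved time: existence and feasibility -/

namespace MSRInstance

variable {J PM PR : Type*} {I : MSRInstance J PM PR}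

theorem IsTimeUnit.le_shuffleReduce {u : ℝ} (hu : I.IsTimeUnit u) (i : PR) (j : J)
    (r : Fin (I.numReduce j)) (h : I.shuffleReduce.pReduce i j r ≠ 0) :
    u ≤ I.shuffleReduce.pReduce i j r := by
  change I.pReduce i j r + ∑ k, I.transfer j r k ≠ 0 at h
  change u ≤ I.pReduce i j r + ∑ k, I.transfer j r k
  have h0 := I.pReduce_nonneg i j r
  have h1 : 0 ≤ ∑ k, I.transfer j r k := Finset.sum_nonneg fun k _ => I.transfer_nonneg j r k
  by_cases hp : I.pReduce i j r = 0
  · rw [hp, zero_add] at h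
    obtain ⟨k, hk, hne⟩ := Finset.exists_ne_zero_of_sum_ne_zero h
    have h2 := Finset.single_le_sum (f := fun k => I.transfer j r k)
      (fun k _ => I.transfer_nonneg j r k) hk
    linarith [hu.le_transfer j r k hne]
  · linarith [hu.le_pReduce i j r hp]

variable [Fintype J] [Fintype PM] [Fintype PR] [Nonempty PM] [Nonempty PR] {u : ℝ}

theorem exists_MRSRun (hu : I.IsTimeUnit u) : Nonempty (I.MRSRun u) := by
  obtain ⟨run⟩ := MRInstance.exists_MRSRun (I := I.shuffleReduce) (u := u)
    (Stage.exists_taskSchedulingRun _ hu.pos I.w_pos (fun i k => I.pMap_nonneg i k.1 k.2)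
      (fun i k => hu.le_pMap i k.1 k.2))
    (Stage.exists_taskSchedulingRun _ hu.pos I.w_pos
      (fun i r => I.shuffleReduce.pReduce_nonneg i r.1 r.2)
      (fun i r => hu.le_shuffleReduce i r.1 r.2))
  exact ⟨⟨run, fun _ _ k => k, fun _ _ => Fin.val_injective⟩⟩

namespace MRSRun

variable (A : I.MRSRun u)

theorem schedule_reduceFinish (r : I.ReduceTask) : A.schedule.reduceFinish r =
    A.run.reduceStart r +
      I.shuffleReduce.pReduce (A.run.reduceRun.proc r) r.1 r.2 := by
  change A.run.reduceStart r + ∑ k, I.transfer r.1 r.2 k +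
    I.pReduce (A.run.reduceRun.proc r) r.1 r.2 = A.run.reduceStart r +
      (I.pReduce (A.run.reduceRun.proc r) r.1 r.2 + ∑ k, I.transfer r.1 r.2 k)
  ring

/-- The Shuffle tasks of a Reduce task are executed in the reserved time. -/
theorem reduceStart_le_shuffleStart (h : I.ShuffleTask) :
    A.run.reduceStart ⟨h.1, h.2.1⟩ ≤ A.schedule.shuffleStart h :=
  le_add_of_nonneg_right (Finset.sum_nonneg fun k _ => I.transfer_nonneg _ _ k)

theorem shuffleFinish_le_shuffleStart (j : J) (r : Fin (I.numReduce j)) (k k' : Fin (I.numMap j))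
    (h : A.order j r k < A.order j r k') :
    A.schedule.shuffleFinish ⟨j, (r, k)⟩ ≤ A.schedule.shuffleStart ⟨j, (r, k')⟩ := by
  change A.run.reduceStart ⟨j, r⟩ +
      ∑ l with A.order j r l < A.order j r k, I.transfer j r l + I.transfer j r k ≤
    A.run.reduceStart ⟨j, r⟩ + ∑ l with A.order j r l < A.order j r k', I.transfer j r l
  rw [add_assoc, add_comm (∑ l with A.order j r l < A.order j r k, I.transfer j r l),
    ← Finset.sum_insert (by simp)]
  refine add_le_add le_rfl (Finset.sum_le_sum_of_subset_of_nonneg (fun l hl => ?_)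
    (fun l _ _ => I.transfer_nonneg j r l))
  rcases Finset.mem_insert.1 hl with rfl | hl
  · simpa using h
  · simp only [Finset.mem_filter, Finset.mem_univ, true_and] at hl ⊢
    exact hl.trans h

theorem shuffleFinish_le_reduceStart (h : I.ShuffleTask) :
    A.schedule.shuffleFinish h ≤ A.schedule.reduceStart ⟨h.1, h.2.1⟩ := by
  obtain ⟨j, r, k⟩ := h
  change A.run.reduceStart ⟨j, r⟩ +
      ∑ l with A.order j r l < A.order j r k, I.transfer j r l + I.transfer j r k ≤
    A.run.reduceStart ⟨j, r⟩ + ∑ l, I.transfer j r l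
  rw [add_assoc, add_comm (∑ l with A.order j r l < A.order j r k, I.transfer j r l),
    ← Finset.sum_insert (by simp)]
  exact add_le_add le_rfl (Finset.sum_le_sum_of_subset_of_nonneg (Finset.subset_univ _)
    (fun l _ _ => I.transfer_nonneg j r l))

/-- Reserved blocks of different Reduce tasks do not overlap, and inside a block the Shuffle tasks
follow one another before the Reduce task. The width separates Map tasks from the blocks: Map tasks
end by it, blocks begin after it. -/
theorem schedule_feasible : A.schedule.Feasible := by
  have hstart : ∀ r : I.ReduceTask, 0 ≤ A.run.reduceStart r := fun r =>
    (A.run.jobWidth_nonneg r.1).trans (A.run.jobWidth_le_reduceStart r)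
  have hres : ∀ r : I.ReduceTask, A.run.reduceStart r ≤ A.schedule.reduceStart r := fun r =>
    le_add_of_nonneg_right (Finset.sum_nonneg fun k _ => I.transfer_nonneg r.1 r.2 k)
  have hfin : ∀ r : I.ReduceTask, A.schedule.reduceStart r ≤ A.schedule.reduceFinish r := fun r =>
    le_add_of_nonneg_right (I.pReduce_nonneg _ r.1 r.2)
  -- The Reduce task whose reserved block contains the given task.
  let red : I.ReduceTask ⊕ I.ShuffleTask → I.ReduceTask := Sum.elim id (fun h => ⟨h.1, h.2.1⟩)
  have hlow : ∀ a, A.run.reduceStart (red a) ≤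
      Sum.elim A.schedule.reduceStart A.schedule.shuffleStart a := by
    rintro (r | h)
    · exact hres r
    · exact A.reduceStart_le_shuffleStart h
  have hup : ∀ a, Sum.elim A.schedule.reduceFinish A.schedule.shuffleFinish a ≤
      A.schedule.reduceFinish (red a) := by
    rintro (r | h)
    · exact le_rfl
    · exact (A.shuffleFinish_le_reduceStart h).trans (hfin _)
  refine ⟨A.run.mapStart_nonneg, fun h => (hstart _).trans (A.reduceStart_le_shuffleStart h),
    fun r => (hstart r).trans (hres r), A.run.map_nonOverlapping, ?_, ?_,
    fun j r k => A.shuffleFinish_le_reduceStart ⟨j, (r, k)⟩⟩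
  · intro a b hab hproc
    by_cases hred : red a = red b
    · rcases a with r | ⟨j, r, k⟩ <;> rcases b with r' | ⟨j', r', k'⟩
      · exact absurd (congrArg Sum.inl hred) hab
      · right
        have h : r = ⟨j', r'⟩ := hred
        subst h
        exact A.shuffleFinish_le_reduceStart ⟨j', (r', k')⟩
      · left
        have h : ⟨j, r⟩ = r' := hred
        subst h
        exact A.shuffleFinish_le_reduceStart ⟨j, (r, k)⟩
      · have h : (⟨j, r⟩ : I.ReduceTask) = ⟨j', r'⟩ := hred
        cases h
        rcases lt_trichotomy (A.order j r k) (A.order j r k') with h | h | h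
        · exact Or.inl (A.shuffleFinish_le_shuffleStart j r k k' h)
        · exact absurd (by rw [A.order_injective j r h]) hab
        · exact Or.inr (A.shuffleFinish_le_shuffleStart j r k' k h)
    · have hproc' : A.run.reduceRun.proc (red a) = A.run.reduceRun.proc (red b) := by
        rcases a with r | h <;> rcases b with r' | h' <;> exact hproc
      rcases A.run.reduce_nonOverlapping _ _ hred hproc' with h | h
      · left
        refine (hup a).trans (le_trans ?_ (hlow b))
        rw [schedule_reduceFinish]
        exact h
      · right
        refine (hup b).trans (le_trans ?_ (hlow a))
        rw [schedule_reduceFinish]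
        exact h
  · intro j r k
    exact (A.run.map_finish_le ⟨j, k⟩).trans ((A.run.jobWidth_le_reduceStart ⟨j, r⟩).trans
      (A.reduceStart_le_shuffleStart ⟨j, (r, k)⟩))

theorem schedule_jobFinish_le (hu : 0 < u) (j : J) :
    A.schedule.jobFinish j ≤ 27 * (A.run.mapRun.D j + A.run.reduceRun.D j) := by
  refine Finset.sup'_le _ _ fun r _ => ?_
  rw [schedule_reduceFinish]
  have h1 : A.run.reduceStart ⟨j, r⟩ +
      I.shuffleReduce.pReduce (A.run.reduceRun.proc ⟨j, r⟩) j r ≤ 2 * A.run.jobWidth j :=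
    A.run.reduce_finish_le ⟨j, r⟩
  have h2 := A.run.jobWidth_le hu j
  exact h1.trans (by linarith)

end MRSRun

end MSRInstance

/-! ### Lower bounds from an arbitrary feasible schedule -/

namespace MSRSchedule

variable {J PM PR : Type*} {I : MSRInstance J PM PR} {σ : MSRSchedule I}

theorem reduceFinish_le_jobFinish (σ : MSRSchedule I) (r : I.ReduceTask) :
    σ.reduceFinish r ≤ σ.jobFinish r.1 :=
  Finset.le_sup' (fun r' => σ.reduceFinish ⟨r.1, r'⟩) (Finset.mem_univ r.2)

theorem reduceStart_le_reduceFinish (σ : MSRSchedule I) (r : I.ReduceTask) :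
    σ.reduceStart r ≤ σ.reduceFinish r :=
  le_add_of_nonneg_right (I.pReduce_nonneg _ r.1 r.2)

theorem shuffleStart_le_shuffleFinish (σ : MSRSchedule I) (h : I.ShuffleTask) :
    σ.shuffleStart h ≤ σ.shuffleFinish h :=
  le_add_of_nonneg_right (I.transfer_nonneg _ _ _)

theorem mapStart_le_mapFinish (σ : MSRSchedule I) (k : I.MapTask) :
    σ.mapStart k ≤ σ.mapFinish k :=
  le_add_of_nonneg_right (I.pMap_nonneg _ k.1 k.2)

namespace Feasible

theorem jobFinish_nonneg (hσ : σ.Feasible) (j : J) : 0 ≤ σ.jobFinish j :=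
  (hσ.reduceStart_nonneg ⟨j, ⟨0, I.numReduce_pos j⟩⟩).trans
    ((σ.reduceStart_le_reduceFinish _).trans (σ.reduceFinish_le_jobFinish _))

/-- Every job has a Reduce task, and it waits for this Map task through their Shuffle task. -/
theorem mapFinish_le_jobFinish (hσ : σ.Feasible) (k : I.MapTask) :
    σ.mapFinish k ≤ σ.jobFinish k.1 :=
  (hσ.map_before_shuffle k.1 ⟨0, I.numReduce_pos k.1⟩ k.2).trans
    ((σ.shuffleStart_le_shuffleFinish _).trans ((hσ.shuffle_before_reduce _ _ _).trans
      ((σ.reduceStart_le_reduceFinish _).trans (σ.reduceFinish_le_jobFinish _))))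

/-- The Reduce tasks of a processor that are completed by the time `W`, and their Shuffle tasks,
have total length at most `W`. -/
theorem reduce_load_le [Fintype J] (hσ : σ.Feasible) (i : PR) {W : ℝ} (hW : 0 ≤ W)
    (B : Finset I.ReduceTask) (hB : ∀ r ∈ B, σ.reduceProc r = i ∧ σ.reduceFinish r ≤ W) :
    ∑ r ∈ B, (I.pReduce i r.1 r.2 + ∑ k, I.transfer r.1 r.2 k) ≤ W := by
  classical
  have h := hσ.reduce_nonOverlapping.sum_le
    (by rintro (r | s); exacts [hσ.reduceStart_nonneg r, hσ.shuffleStart_nonneg s])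
    (by rintro (r | s); exacts [σ.reduceStart_le_reduceFinish r, σ.shuffleStart_le_shuffleFinish s])
    -- To the Reduce tasks in `B` all their Shuffle tasks are added; these run on the same processor
    -- and end before their Reduce task starts.
    i hW (B.disjSum (Finset.univ.filter fun s : I.ShuffleTask => ⟨s.1, s.2.1⟩ ∈ B))
    (by
      rintro (r | s) ha
      · exact hB r (Finset.inl_mem_disjSum.1 ha)
      · obtain ⟨h1, h2⟩ := hB _ (Finset.mem_filter.1 (Finset.inr_mem_disjSum.1 ha)).2
        exact ⟨h1, (hσ.shuffle_before_reduce s.1 s.2.1 s.2.2).trans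
          ((σ.reduceStart_le_reduceFinish _).trans h2)⟩)
  rw [Finset.sum_disjSum] at h
  refine le_trans (le_of_eq ?_) h
  rw [Finset.sum_add_distrib]
  congr 1
  · refine Finset.sum_congr rfl fun r hr => ?_
    simp only [Sum.elim_inl]
    rw [reduceFinish, (hB r hr).1, add_sub_cancel_left]
  · rw [Finset.sum_sigma']
    refine Finset.sum_nbij' (fun z => (⟨z.1.1, (z.1.2, z.2)⟩ : I.ShuffleTask))
      (fun s => ⟨⟨s.1, s.2.1⟩, s.2.2⟩) ?_ ?_ ?_ ?_ ?_
    · intro z hz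
      simpa using hz
    · intro s hs
      simpa using hs
    · intro z _; rfl
    · intro s _; rfl
    · intro z _
      simp only [Sum.elim_inr]
      rw [shuffleFinish, add_sub_cancel_left]

theorem exists_mapStage_LPFeasible [Fintype J] [Fintype PM] [Nonempty PM] {u : ℝ}
    (hσ : σ.Feasible) (hu : I.IsTimeUnit u) :
    ∃ y, I.shuffleReduce.mapStage.LPFeasible u y σ.mapFinish σ.jobFinish := by
  refine Stage.exists_LPFeasible hu.pos
    (fun k hk i => hu.le_pMap i k.1 k.2 (Stage.mem_active.1 hk i).ne') σ.mapProc _ _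
    hσ.jobFinish_nonneg (fun k _ => hσ.mapFinish_le_jobFinish k)
    (fun k _ => le_add_of_nonneg_left (hσ.mapStart_nonneg k)) ?_
  intro i W hW B _ hB
  refine le_trans (le_of_eq ?_) (hσ.map_nonOverlapping.sum_le hσ.mapStart_nonneg
    σ.mapStart_le_mapFinish i hW B hB)
  refine Finset.sum_congr rfl fun k hk => ?_
  rw [mapFinish, add_sub_cancel_left, (hB k hk).1]
  rfl

/-- The transfers need not be adjacent to their Reduce task in `σ`; only total load up to a given
time matters to the linear program, and this is what `reduce_load_le` controls. -/
theorem exists_reduceStage_LPFeasible [Fintype J] [Fintype PR] [Nonempty PR] {u : ℝ}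
    (hσ : σ.Feasible) (hu : I.IsTimeUnit u) :
    ∃ y, I.shuffleReduce.reduceStage.LPFeasible u y σ.reduceFinish σ.jobFinish := by
  have hload := fun (i : PR) (W : ℝ) (hW : 0 ≤ W) => hσ.reduce_load_le i hW
  refine Stage.exists_LPFeasible hu.pos
    (fun r hr i => hu.le_shuffleReduce i r.1 r.2 (Stage.mem_active.1 hr i).ne') σ.reduceProc _ _
    hσ.jobFinish_nonneg (fun r _ => σ.reduceFinish_le_jobFinish r) ?_
    (fun i W hW B _ hB => hload i W hW B hB)
  intro r _
  have h0 : 0 ≤ σ.reduceFinish r :=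
    (hσ.reduceStart_nonneg r).trans (σ.reduceStart_le_reduceFinish r)
  -- The load bound for a single task shows that its modified processing time fits before its
  -- completion.
  have h := hload (σ.reduceProc r) _ h0 {r} (by simp)
  rwa [Finset.sum_singleton] at h

end Feasible

end MSRSchedule

/-- Optimality of the two LP solutions puts each weighted sum of dummy completion times below the
cost of `σ`; each enters with factor `27`. -/
theorem MSRInstance.MRSRun.cost_le {J PM PR : Type*} [Fintype J] [Fintype PM] [Fintype PR]
    [Nonempty PM] [Nonempty PR] {I : MSRInstance J PM PR} {u : ℝ} (hu : I.IsTimeUnit u)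
    (A : I.MRSRun u) {σ : MSRSchedule I} (hσ : σ.Feasible) : A.schedule.cost ≤ 54 * σ.cost := by
  obtain ⟨yM, hM⟩ := hσ.exists_mapStage_LPFeasible hu
  obtain ⟨yR, hR⟩ := hσ.exists_reduceStage_LPFeasible hu
  have h1 : ∑ j, I.w j * A.run.mapRun.D j ≤ σ.cost := A.run.mapRun.optimal.2 _ _ _ hM
  have h2 : ∑ j, I.w j * A.run.reduceRun.D j ≤ σ.cost := A.run.reduceRun.optimal.2 _ _ _ hR
  calc A.schedule.cost
      ≤ ∑ j, (27 * (I.w j * A.run.mapRun.D j) + 27 * (I.w j * A.run.reduceRun.D j)) := by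
        refine Finset.sum_le_sum fun j _ => ?_
        have h3 := mul_le_mul_of_nonneg_left (A.schedule_jobFinish_le hu.pos j) (I.w_pos j).le
        linarith
    _ = 27 * ∑ j, I.w j * A.run.mapRun.D j + 27 * ∑ j, I.w j * A.run.reduceRun.D j := by
        rw [Finset.sum_add_distrib, Finset.mul_sum, Finset.mul_sum]
    _ ≤ 54 * σ.cost := by linarith

end MapReduce

theorem theorem3 {J PM PR : Type*} [Fintype J] [Fintype PM] [Fintype PR]
    [Nonempty PM] [Nonempty PR]
    (I : MapReduce.MSRInstance J PM PR) (u : ℝ) (hu : I.IsTimeUnit u) :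
    Nonempty (I.MRSRun u) ∧
      ∀ A : I.MRSRun u,
        A.schedule.Feasible ∧
          ∀ σ : MapReduce.MSRSchedule I, σ.Feasible → A.schedule.cost ≤ 54 * σ.cost :=
  ⟨MapReduce.MSRInstance.exists_MRSRun hu,
    fun A => ⟨A.schedule_feasible, fun _ hσ => A.cost_le hu hσ⟩⟩
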